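/- Let $(V,d)$ be a metric space, regarded as the complete graph on $V$ in which the edge $\{u,v\}$ has length $d(u,v)$; the cost $c(E)$ of a finite set $E$ of edges is the sum of the lengths of its edges. In the online (multi-source) rent-or-buy problem the algorithm is given a number $M\ge 0$ in advance. Pairs of terminals $(s_1,t_1),(s_2,t_2),\dots,(s_N,t_N)$ in $V$ arrive one by one, where $N$ is finite and not known in advance. When $(s_i,t_i)$ arrives, the algorithm knows only $M$ and the distances between the terminals that have arrived so far. It then irrevocably adds zero or more edges between arrived terminals to the set $H$ of bought edges (initially empty) and chooses a set $Q_i$ of such edges to rent, so that $s_i$ and $t_i$ are connected in $H\cup Q_i$. A bought edge stays in $H$ forever; the edges of $Q_i$ can be used in step $i$ only. The total cost of the algorithm is $M\,c(H)+\sum_i c(Q_i)$, with $H$ the final set of bought edges. Let $\mathrm{OPT}$ be the infimum of $M\,c(H)+\sum_i c(Q_i)$ over all finite sets $H,Q_1,\dots,Q_N$ of edges of the complete graph on $V$ such that $H\cup Q_i$ connects $s_i$ and $t_i$ for every $i$, and let $k$ be the number of distinct vertices among $s_1,t_1,\dots,s_N,t_N$. Theorem. There is a deterministic $O(\log k)$-competitive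 algorithm for the online rent-or-buy problem: there are a deterministic online algorithm and an absolute constant $C>0$ such that, for every metric space $(V,d)$, every $M\ge 0$ and every finite sequence of terminal pairs, the algorithm connects every pair upon its arrival and its total cost is at most $C\log k\cdot\mathrm{OPT}$. (If no terminal has arrived, $\log k$ is read as $0$; the total cost is then $0$.) -/

import Mathlib

/-!
The online (multi-source) rent-or-buy problem on the complete graph of a metric space.
-/

namespace RentOrBuy

noncomputable section

open scoped Classical

/-! ### Requests, edges and costs -/

/-- Names of the `2 m` terminals of the first `m` requests, in order of arrival: `(i, false)` is the
first terminal `s_i` of the `i`-th pair and `(i, true)` is its second terminal `t_i`. -/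
abbrev TerminalIndex (m : ℕ) : Type := Fin m × Bool

/-- The vertex at which a terminal of the request sequence `σ` (`σ i = (s_i, t_i)`) is located. -/
def terminal {V : Type*} {n : ℕ} (σ : Fin n → V × V) (a : TerminalIndex n) : V :=
  if a.2 then (σ a.1).2 else (σ a.1).1

/-- The number `k` of terminals of a request sequence: a vertex that is requested several times is
counted once. -/
def numTerminals {V : Type*} {n : ℕ} (σ : Fin n → V × V) : ℕ :=
  (Finset.univ.image (terminal σ)).card

/-- The length `d(u, v)` of the edge `{u, v}`. -/
def edgeLength {V : Type*} [MetricSpace V] (e : Sym2 V) : ℝ :=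
  Sym2.lift ⟨fun u v => dist u v, fun u v => dist_comm u v⟩ e

/-- The cost `c(H)` of a finite set of edges: the sum of the lengths of its edges. -/
def edgeCost {V : Type*} [MetricSpace V] (H : Finset (Sym2 V)) : ℝ :=
  ∑ e ∈ H, edgeLength e

/-- The vertices `u` and `v` are connected in the subgraph with edge set `E`. -/
def Connects {V : Type*} (E : Set (Sym2 V)) (u v : V) : Prop :=
  (SimpleGraph.fromEdgeSet E).Reachable u v

/-- The total cost `M c(H) + ∑ i, c(Q i)` of buying the edges `H` and renting the edges `Q i` for
the `i`-th request. -/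
def totalCost {V : Type*} [MetricSpace V] {n : ℕ} (M : ℝ) (H : Finset (Sym2 V))
    (Q : Fin n → Finset (Sym2 V)) : ℝ :=
  M * edgeCost H + ∑ i, edgeCost (Q i)

/-! ### The offline optimum -/

/-- An offline solution: bought edges `H` and rented edges `Q i` such that `H ∪ Q i` connects
`s_i` and `t_i` for every `i`. All vertices of the underlying graph may be used. -/
def IsOfflineSolution {V : Type*} {n : ℕ} (σ : Fin n → V × V) (H : Finset (Sym2 V))
    (Q : Fin n → Finset (Sym2 V)) : Prop :=
  ∀ i, Connects ((H : Set (Sym2 V)) ∪ (Q i : Set (Sym2 V))) (σ i).1 (σ i).2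

/-- The cost `OPT` of an optimal offline solution: the infimum of the total costs of the offline
solutions. -/
def opt {V : Type*} [MetricSpace V] {n : ℕ} (M : ℝ) (σ : Fin n → V × V) : ℝ :=
  sInf {x : ℝ | ∃ (H : Finset (Sym2 V)) (Q : Fin n → Finset (Sym2 V)),
    IsOfflineSolution σ H Q ∧ x = totalCost M H Q}

/-- The infimum in `opt` is over a nonempty set: renting `{s_i, t_i}` at each step is a solution. -/
theorem exists_isOfflineSolution {V : Type*} {n : ℕ} (σ : Fin n → V × V) :
    ∃ (H : Finset (Sym2 V)) (Q : Fin n → Finset (Sym2 V)), IsOfflineSolution σ H Q := by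
  refine ⟨∅, fun i => {s((σ i).1, (σ i).2)}, fun i => ?_⟩
  by_cases h : (σ i).1 = (σ i).2
  · unfold Connects
    rw [h]
  · refine SimpleGraph.Adj.reachable ?_
    rw [SimpleGraph.fromEdgeSet_adj]
    exact ⟨by simp, h⟩

/-- The infimum in `opt` is over a set of nonnegative numbers. -/
theorem totalCost_nonneg {V : Type*} [MetricSpace V] {n : ℕ} {M : ℝ} (hM : 0 ≤ M)
    (H : Finset (Sym2 V)) (Q : Fin n → Finset (Sym2 V)) : 0 ≤ totalCost M H Q := by
  have hlen : ∀ e : Sym2 V, 0 ≤ edgeLength e := by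
    intro e
    induction e using Sym2.ind with
    | _ u v => exact dist_nonneg
  have hc : ∀ E : Finset (Sym2 V), 0 ≤ edgeCost E := fun E => Finset.sum_nonneg fun e _ => hlen e
  exact add_nonneg (mul_nonneg hM (hc H)) (Finset.sum_nonneg fun i _ => hc (Q i))

/-! ### Deterministic online algorithms -/

/-- A deterministic online algorithm. It knows the parameter `M` in advance. When the request number
`m` (counted from `0`) arrives, it knows in addition only the pairwise distances of the terminals of
the requests `0, …, m` (which determine which of them coincide), and it chooses a finite set of
edges to buy and a finite set of edges to rent between these terminals. It knows neither the rest of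
the metric space nor the later requests nor their number. (Its own earlier decisions are functions
of the same data, so they need not be passed on.) -/
structure OnlineAlgorithm where
  /-- The edges that are bought at step `m`. -/
  buy : (M : ℝ) → (m : ℕ) → (TerminalIndex (m + 1) → TerminalIndex (m + 1) → ℝ) →
    Finset (Sym2 (TerminalIndex (m + 1)))
  /-- The edges that are rented at step `m`. -/
  rent : (M : ℝ) → (m : ℕ) → (TerminalIndex (m + 1) → TerminalIndex (m + 1) → ℝ) →
    Finset (Sym2 (TerminalIndex (m + 1)))

/-- The location of the terminals of the requests `0, …, i`. -/
def seenTerminal {V : Type*} {n : ℕ} (σ : Fin n → V × V) (i : Fin n)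
    (a : TerminalIndex ((i : ℕ) + 1)) : V :=
  terminal σ (Fin.castLE i.isLt a.1, a.2)

/-- The submetric over the terminals of the requests `0, …, i`. -/
def seenDist {V : Type*} [MetricSpace V] {n : ℕ} (σ : Fin n → V × V) (i : Fin n)
    (a b : TerminalIndex ((i : ℕ) + 1)) : ℝ :=
  dist (seenTerminal σ i a) (seenTerminal σ i b)

namespace OnlineAlgorithm

variable {V : Type*} [MetricSpace V] {n : ℕ}

/-- The edges of the graph that the algorithm buys at step `i`. -/
def boughtAt (A : OnlineAlgorithm) (M : ℝ) (σ : Fin n → V × V) (i : Fin n) : Finset (Sym2 V) :=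
  (A.buy M i (seenDist σ i)).image (Sym2.map (seenTerminal σ i))

/-- The edges `Q_i` of the graph that the algorithm rents at step `i`. -/
def rentedAt (A : OnlineAlgorithm) (M : ℝ) (σ : Fin n → V × V) (i : Fin n) : Finset (Sym2 V) :=
  (A.rent M i (seenDist σ i)).image (Sym2.map (seenTerminal σ i))

/-- The subgraph `H` of bought edges right after step `i`. -/
def boughtUpTo (A : OnlineAlgorithm) (M : ℝ) (σ : Fin n → V × V) (i : Fin n) :
    Finset (Sym2 V) :=
  (Finset.Iic i).biUnion (A.boughtAt M σ)

/-- The subgraph `H` of bought edges at the end. -/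
def bought (A : OnlineAlgorithm) (M : ℝ) (σ : Fin n → V × V) : Finset (Sym2 V) :=
  Finset.univ.biUnion (A.boughtAt M σ)

/-- The algorithm serves every request of `σ` when it arrives: `s_i` and `t_i` are connected by the
edges bought up to step `i` together with the edges rented at step `i`. -/
def Serves (A : OnlineAlgorithm) (M : ℝ) (σ : Fin n → V × V) : Prop :=
  ∀ i, Connects ((A.boughtUpTo M σ i : Set (Sym2 V)) ∪ (A.rentedAt M σ i : Set (Sym2 V)))
    (σ i).1 (σ i).2

/-- The total cost `M c(H) + ∑ i, c(Q_i)` of the algorithm on `σ`. -/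
def cost (A : OnlineAlgorithm) (M : ℝ) (σ : Fin n → V × V) : ℝ :=
  totalCost M (A.bought M σ) (A.rentedAt M σ)

end OnlineAlgorithm

end

end RentOrBuy

namespace RentOrBuy

open scoped Classical
open MeasureTheory

noncomputable section

/-! ### Random ball partitions -/

/-! The cost is measured by charges. A request of positive length is charged `2 ^ ℓ`, where `ℓ` is
the highest level, not above the scale of its length, at which one of its terminals has no hub
within `2 * 2 ^ ℓ`. That terminal receives the charge and becomes a hub of level `ℓ` if at least `M`
charges of level `ℓ`, its own included, lie within `2 ^ ℓ`. Let `Φ` be the sum of all charges.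
Renting costs at most `8 Φ` (`rentEdges_cost_le`). Hubs of one level are far apart, so they own
disjoint groups of at least `M` charges. Since a forest has no more edges than vertices, the bought
forest costs at most `9 Φ` (`hubs_cost_le`, `forest_cost_le`).

Conversely, split the space at scale `ℓ` into classes of diameter below `2 ^ ℓ`. This separates
every pair charged at level `ℓ`, and a class receives at most `M + 1` charges
(`Invariant.class_card`). An offline solution either buys an edge leaving the class or rents one for
each of these requests, so the charges are bounded by the weighted number of cut edges
(`card_le_load_isCut`).

Cut edges become cost by averaging over ball partitions around the `k` terminals in random order:
the cut probability of an edge, integrated over all radii, is at most the harmonic number of `k`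
times its length (`exists_cutFraction_bound`). Different scales use disjoint ranges of radii, so
together they lose one logarithm only (`sum_scales_le`, `potential_le`). The randomness is confined
to the analysis. The case `M < 1` reduces to `M = 1` by buying whatever would be rented. -/

theorem sum_inv_card_le_harmonic {ι : Type*} (f : ι → ℝ) (s : Finset ι) :
    ∑ w ∈ s, (1 : ℝ) / ({w' ∈ s | f w' ≤ f w}.card : ℝ) ≤ (harmonic s.card : ℝ) := by
  induction hn : s.card generalizing s with
  | zero => simp [Finset.card_eq_zero.1 hn]
  | succ n ih =>
    have hs : s.Nonempty := Finset.card_pos.1 (by omega)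
    -- An element of largest value contributes exactly `1 / |s|`. Removing it can only enlarge the
    -- other terms, so ties do no harm.
    obtain ⟨m, hm, hmax⟩ := Finset.exists_max_image s f hs
    rw [← Finset.add_sum_erase s _ hm]
    have hall : {w' ∈ s | f w' ≤ f m} = s := Finset.filter_true_of_mem hmax
    have herase := ih (s.erase m) (by rw [Finset.card_erase_of_mem hm, hn]; rfl)
    rw [hall, hn, harmonic_succ]
    push_cast
    have hle : ∑ w ∈ s.erase m, (1 : ℝ) / ({w' ∈ s | f w' ≤ f w}.card : ℝ) ≤
        ∑ w ∈ s.erase m, (1 : ℝ) / ({w' ∈ s.erase m | f w' ≤ f w}.card : ℝ) := by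
      refine Finset.sum_le_sum fun w hw => ?_
      apply one_div_le_one_div_of_le
      · exact_mod_cast Finset.card_pos.2 ⟨w, by simp_all⟩
      · exact_mod_cast Finset.card_le_card
          (Finset.filter_subset_filter _ (Finset.erase_subset _ _))
    have h1 : (1 : ℝ) / ((n : ℝ) + 1) = ((n : ℝ) + 1)⁻¹ := one_div _
    rw [h1]
    linarith

/-- Each element of `B` is the first one of `B` in at most `1 / |B|` of all orders. -/
theorem card_mul_card_first_le {k : ℕ} (B : Finset (Fin k)) {w : Fin k} (hw : w ∈ B) :
    B.card * ({π : Equiv.Perm (Fin k) | ∀ w' ∈ B, π w ≤ π w'} : Finset _).card ≤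
      Fintype.card (Equiv.Perm (Fin k)) := by
  have hcard : ∀ v ∈ B,
      ({π : Equiv.Perm (Fin k) | ∀ w' ∈ B, π w ≤ π w'} : Finset _).card ≤
      ({π : Equiv.Perm (Fin k) | ∀ w' ∈ B, π v ≤ π w'} : Finset _).card := by
    intro v hv
    -- Precomposing with the transposition of `v` and `w` injects the orders with `w` first into
    -- those with `v` first. For different `v` the latter are disjoint.
    refine Finset.card_le_card_of_injOn (fun π => π * Equiv.swap v w) ?_ ?_
    · intro π hπ
      simp only [Finset.coe_filter, Finset.mem_univ, true_and, Set.mem_ofPred_eq] at hπ ⊢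
      intro w' hw'
      simp only [Equiv.Perm.coe_mul, Function.comp_apply, Equiv.swap_apply_left]
      apply hπ
      rw [Equiv.swap_apply_def]
      split_ifs <;> assumption
    · intro π _ π' _ h
      exact mul_right_cancel h
  calc _ = ∑ _v ∈ B, ({π : Equiv.Perm (Fin k) | ∀ w' ∈ B, π w ≤ π w'} : Finset _).card := by simp
    _ ≤ ∑ v ∈ B, ({π : Equiv.Perm (Fin k) | ∀ w' ∈ B, π v ≤ π w'} : Finset _).card :=
        Finset.sum_le_sum hcard
    _ = (B.biUnion fun v =>
          ({π : Equiv.Perm (Fin k) | ∀ w' ∈ B, π v ≤ π w'} : Finset _)).card := by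
        refine (Finset.card_biUnion ?_).symm
        intro v hv v' hv' hne
        refine Finset.disjoint_left.2 fun π h h' => hne ?_
        simp only [Finset.mem_filter, Finset.mem_univ, true_and] at h h'
        exact π.injective (le_antisymm (h v' hv') (h' v hv))
    _ ≤ _ := Finset.card_le_univ _

section Cells

variable {V : Type*} [MetricSpace V] {k : ℕ}

/-- The rank in the order `π` of the first center within distance `r` of `v`; it is `⊤` if there is
no such center. -/
def cell (c : Fin k → V) (π : Equiv.Perm (Fin k)) (r : ℝ) (v : V) : WithTop (Fin k) :=
  ({w | dist v (c w) ≤ r} : Finset (Fin k)).inf fun w => (π w : WithTop (Fin k))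

theorem cell_le {c : Fin k → V} {π : Equiv.Perm (Fin k)} {r : ℝ} {v : V} {w : Fin k}
    (h : dist v (c w) ≤ r) : cell c π r v ≤ (π w : WithTop (Fin k)) :=
  Finset.inf_le (f := fun w => (π w : WithTop (Fin k))) (by simpa using h)

theorem exists_cell_eq {c : Fin k → V} {π : Equiv.Perm (Fin k)} {r : ℝ} {v : V}
    (h : cell c π r v ≠ ⊤) : ∃ w, dist v (c w) ≤ r ∧ cell c π r v = (π w : WithTop (Fin k)) := by
  have hne : ({w | dist v (c w) ≤ r} : Finset (Fin k)).Nonempty := by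
    by_contra hne
    rw [Finset.not_nonempty_iff_eq_empty] at hne
    exact h (by simp [cell, hne])
  obtain ⟨w, hw, hwe⟩ := Finset.exists_mem_eq_inf _ hne (fun w => (π w : WithTop (Fin k)))
  exact ⟨w, by simpa using hw, hwe⟩

/-- Equal finite ranks mean a common center. The value `⊤` is excluded because points far from all
centers share it. -/
theorem dist_le_of_cell_eq {c : Fin k → V} {π : Equiv.Perm (Fin k)} {r : ℝ} {u v : V}
    (h : cell c π r u = cell c π r v) (hu : cell c π r u ≠ ⊤) : dist u v ≤ 2 * r := by
  obtain ⟨w, hw, hwe⟩ := exists_cell_eq hu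
  obtain ⟨w', hw', hwe'⟩ := exists_cell_eq (h ▸ hu)
  have : w = w' := π.injective (WithTop.coe_injective (hwe.symm.trans (h.trans hwe')))
  subst this
  have := dist_triangle_right u v (c w)
  linarith

theorem cell_center_ne_top (c : Fin k → V) (π : Equiv.Perm (Fin k)) {r : ℝ} (hr : 0 ≤ r)
    (w : Fin k) : cell c π r (c w) ≠ ⊤ := by
  refine ne_top_of_le_ne_top (WithTop.coe_ne_top (a := π w)) (cell_le ?_)
  simpa using hr

/-- Take the cell of smaller rank: its center reaches its own endpoint but not the other one, and no
center reaching either endpoint precedes it. -/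
theorem exists_first_of_cell_ne {c : Fin k → V} {π : Equiv.Perm (Fin k)} {r : ℝ} {u v : V}
    (h : cell c π r u ≠ cell c π r v) :
    ∃ w, min (dist u (c w)) (dist v (c w)) ≤ r ∧ r < max (dist u (c w)) (dist v (c w)) ∧
      ∀ w', min (dist u (c w')) (dist v (c w')) ≤ r → π w ≤ π w' := by
  wlog hlt : cell c π r u < cell c π r v generalizing u v
  · obtain ⟨w, h1, h2, h3⟩ := this h.symm (lt_of_le_of_ne (not_lt.1 hlt) h.symm)
    refine ⟨w, by rwa [min_comm], by rwa [max_comm], fun w' hw' => h3 w' (by rwa [min_comm])⟩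
  obtain ⟨w, hw, hwe⟩ := exists_cell_eq hlt.ne_top
  refine ⟨w, min_le_of_left_le hw, lt_max_of_lt_right ?_, fun w' hw' => ?_⟩
  · by_contra hcon
    exact absurd (hwe ▸ hlt) (not_lt.2 (cell_le (not_lt.1 hcon)))
  · rw [← WithTop.coe_le_coe, ← hwe]
    rcases min_le_iff.1 hw' with h' | h'
    · exact cell_le h'
    · exact hlt.le.trans (cell_le h')

/-- The edge `e` joins two different classes of the colouring `κ`. -/
def IsCut {α : Type*} (κ : V → α) (e : Sym2 V) : Prop := ¬ (e.map κ).IsDiag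

/-- The fraction of orders for which the cells of radius `r` cut the edge `e`. -/
def cutFraction (c : Fin k → V) (r : ℝ) (e : Sym2 V) : ℝ :=
  (∑ π : Equiv.Perm (Fin k), if IsCut (cell c π r) e then (1 : ℝ) else 0) /
    Fintype.card (Equiv.Perm (Fin k))

/-- A center `w` is responsible for a cut only if `r` lies between its distances to the endpoints
and `w` precedes all centers at least as near to the edge. The second event has probability at most
one over the number of these centers. -/
theorem cutFraction_le (c : Fin k → V) (r : ℝ) (u v : V) :
    cutFraction c r s(u, v) ≤ ∑ w, Set.indicator
      (Set.Ico (min (dist u (c w)) (dist v (c w))) (max (dist u (c w)) (dist v (c w))))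
      (fun _ => (1 : ℝ) / (({w' | min (dist u (c w')) (dist v (c w')) ≤
        min (dist u (c w)) (dist v (c w))} : Finset (Fin k)).card : ℝ)) r := by
  set near : Fin k → ℝ := fun w => min (dist u (c w)) (dist v (c w)) with hnear
  set far : Fin k → ℝ := fun w => max (dist u (c w)) (dist v (c w)) with hfar
  set B : Fin k → Finset (Fin k) := fun w => {w' | near w' ≤ near w} with hB
  have hpos : (0 : ℝ) < Fintype.card (Equiv.Perm (Fin k)) := by exact_mod_cast Fintype.card_pos
  change _ ≤ ∑ w, (Set.Ico (near w) (far w)).indicator (fun _ => (1 : ℝ) / ((B w).card : ℝ)) r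
  rw [cutFraction, div_le_iff₀ hpos, Finset.sum_mul]
  calc (∑ π : Equiv.Perm (Fin k), if IsCut (cell c π r) s(u, v) then (1 : ℝ) else 0)
      ≤ ∑ π : Equiv.Perm (Fin k), ∑ w, (Set.Ico (near w) (far w)).indicator
          (fun _ => if ∀ w' ∈ B w, π w ≤ π w' then (1 : ℝ) else 0) r := by
        refine Finset.sum_le_sum fun π _ => ?_
        have hnn : ∀ w, 0 ≤ (Set.Ico (near w) (far w)).indicator
            (fun _ => if ∀ w' ∈ B w, π w ≤ π w' then (1 : ℝ) else 0) r := by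
          intro w
          refine Set.indicator_nonneg (fun _ _ => ?_) _
          split_ifs <;> norm_num
        split_ifs with h
        · have h' : cell c π r u ≠ cell c π r v := by simpa [IsCut] using h
          obtain ⟨w, h1, h2, h3⟩ := exists_first_of_cell_ne h'
          refine le_trans ?_ (Finset.single_le_sum (fun w _ => hnn w) (Finset.mem_univ w))
          rw [Set.indicator_of_mem (show r ∈ Set.Ico (near w) (far w) from ⟨h1, h2⟩), if_pos]
          intro w' hw'
          exact h3 w' ((Finset.mem_filter.1 hw').2.trans h1)
        · exact Finset.sum_nonneg fun w _ => hnn w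
    _ = ∑ w, ∑ π : Equiv.Perm (Fin k), (Set.Ico (near w) (far w)).indicator
          (fun _ => if ∀ w' ∈ B w, π w ≤ π w' then (1 : ℝ) else 0) r := Finset.sum_comm
    _ ≤ _ := by
        refine Finset.sum_le_sum fun w _ => ?_
        by_cases hr : r ∈ Set.Ico (near w) (far w)
        · simp only [Set.indicator_of_mem hr]
          have hBpos : (0 : ℝ) < (B w).card := by
            exact_mod_cast Finset.card_pos.2 ⟨w, by simp [hB]⟩
          rw [Finset.sum_boole, one_div_mul_eq_div, le_div_iff₀ hBpos, mul_comm]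
          exact_mod_cast card_mul_card_first_le (B w) (w := w) (by simp [hB])
        · simp [Set.indicator_of_notMem hr]

/-- The measure of the radii at which an edge is cut is at most a harmonic number times its
length. -/
theorem exists_cutFraction_bound (c : Fin k → V) (e : Sym2 V) :
    ∃ g : ℝ → ℝ, Integrable g ∧ (∀ r, 0 ≤ g r) ∧ (∀ r, cutFraction c r e ≤ g r) ∧
      ∫ r, g r ≤ (harmonic k : ℝ) * edgeLength e := by
  induction e using Sym2.ind with
  | _ u v =>
  have hint : ∀ w : Fin k, Integrable (Set.indicator
      (Set.Ico (min (dist u (c w)) (dist v (c w))) (max (dist u (c w)) (dist v (c w))))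
      (fun _ => (1 : ℝ) / (({w' | min (dist u (c w')) (dist v (c w')) ≤
        min (dist u (c w)) (dist v (c w))} : Finset (Fin k)).card : ℝ))) := by
    intro w
    rw [integrable_indicator_iff measurableSet_Ico]
    exact integrableOn_const (by simp)
  -- Integrating this dominating step function avoids the measurability of `cutFraction` in `r`.
  refine ⟨_, integrable_finsetSum _ fun w _ => hint w, fun r => ?_,
    fun r => by simpa using cutFraction_le c r u v, ?_⟩
  · exact Finset.sum_nonneg fun w _ => Set.indicator_nonneg (fun _ _ => by positivity) _
  · rw [integral_finsetSum _ fun w _ => hint w]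
    have hlen : edgeLength s(u, v) = dist u v := rfl
    have hharm := sum_inv_card_le_harmonic (fun w => min (dist u (c w)) (dist v (c w)))
      (Finset.univ : Finset (Fin k))
    rw [Finset.card_univ, Fintype.card_fin] at hharm
    refine le_trans ?_ (mul_le_mul_of_nonneg_right hharm (hlen ▸ dist_nonneg))
    rw [Finset.sum_mul]
    refine Finset.sum_le_sum fun w _ => ?_
    rw [integral_indicator_const _ measurableSet_Ico, smul_eq_mul, mul_comm, hlen]
    refine mul_le_mul_of_nonneg_left ?_ (by positivity)
    rw [Real.volume_real_Ico, max_sub_min_eq_abs']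
    refine max_le ?_ dist_nonneg
    exact abs_dist_sub_le u v (c w)

end Cells

/-! ### Averaging over all partitions -/

section Load

variable {V : Type*} {n : ℕ}

/-- The total weight `M f(H) + ∑ i, f(Q i)` for a weight function `f` on the edges. -/
def load (M : ℝ) (H : Finset (Sym2 V)) (Q : Fin n → Finset (Sym2 V)) (f : Sym2 V → ℝ) : ℝ :=
  M * ∑ e ∈ H, f e + ∑ i, ∑ e ∈ Q i, f e

theorem load_mono {M : ℝ} (hM : 0 ≤ M) (H : Finset (Sym2 V)) (Q : Fin n → Finset (Sym2 V))
    {f g : Sym2 V → ℝ} (h : ∀ e, f e ≤ g e) : load M H Q f ≤ load M H Q g := by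
  unfold load
  gcongr with e _ i _ e _ <;> exact h e

theorem load_const_mul (M : ℝ) (H : Finset (Sym2 V)) (Q : Fin n → Finset (Sym2 V))
    (a : ℝ) (f : Sym2 V → ℝ) : load M H Q (fun e => a * f e) = a * load M H Q f := by
  simp only [load, ← Finset.mul_sum]
  ring

theorem load_sum {ι : Type*} (s : Finset ι) (M : ℝ) (H : Finset (Sym2 V))
    (Q : Fin n → Finset (Sym2 V)) (f : ι → Sym2 V → ℝ) :
    load M H Q (fun e => ∑ x ∈ s, f x e) = ∑ x ∈ s, load M H Q (f x) := by
  simp only [load, Finset.sum_add_distrib, ← Finset.mul_sum]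
  congr 1
  · rw [Finset.sum_comm]
  · rw [Finset.sum_comm]
    refine Finset.sum_congr rfl fun i _ => ?_
    rw [Finset.sum_comm]

theorem load_edgeLength [MetricSpace V] (M : ℝ) (H : Finset (Sym2 V))
    (Q : Fin n → Finset (Sym2 V)) : load M H Q edgeLength = totalCost M H Q := rfl

theorem integrable_load (M : ℝ) (H : Finset (Sym2 V)) (Q : Fin n → Finset (Sym2 V))
    {g : Sym2 V → ℝ → ℝ} (hg : ∀ e, Integrable (g e)) :
    Integrable fun r => load M H Q fun e => g e r :=
  ((integrable_finsetSum _ fun e _ => hg e).const_mul M).add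
    (integrable_finsetSum _ fun _ _ => integrable_finsetSum _ fun e _ => hg e)

theorem integral_load (M : ℝ) (H : Finset (Sym2 V)) (Q : Fin n → Finset (Sym2 V))
    {g : Sym2 V → ℝ → ℝ} (hg : ∀ e, Integrable (g e)) :
    ∫ r, load M H Q (fun e => g e r) = load M H Q fun e => ∫ r, g e r := by
  unfold load
  rw [integral_add ((integrable_finsetSum _ fun e _ => hg e).const_mul M)
    (integrable_finsetSum _ fun _ _ => integrable_finsetSum _ fun e _ => hg e),
    integral_const_mul, integral_finsetSum _ fun e _ => hg e,
    integral_finsetSum _ fun _ _ => integrable_finsetSum _ fun e _ => hg e]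
  congr 1
  exact Finset.sum_congr rfl fun i _ => integral_finsetSum _ fun e _ => hg e

/-- If at every scale `2 ^ ℓ` all ball partitions of radius about `2 ^ ℓ / 4` cut edges of total
weight at least `a ℓ`, then `∑ 2 ^ ℓ a ℓ` is within a logarithmic factor of the cost. -/
theorem sum_scales_le [MetricSpace V] {k : ℕ} (c : Fin k → V) {M : ℝ} (hM : 0 ≤ M)
    (H : Finset (Sym2 V)) (Q : Fin n → Finset (Sym2 V)) (L : Finset ℤ) (a : ℤ → ℝ)
    (ha : ∀ ℓ ∈ L, ∀ r ∈ Set.Ico ((2 : ℝ) ^ (ℓ - 2)) (2 ^ (ℓ - 1)), ∀ π : Equiv.Perm (Fin k),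
      a ℓ ≤ load M H Q fun e => if IsCut (cell c π r) e then 1 else 0) :
    ∑ ℓ ∈ L, 2 ^ ℓ * a ℓ ≤ 4 * (harmonic k : ℝ) * totalCost M H Q := by
  choose g hgi hg0 hgc hgl using exists_cutFraction_bound c
  set h : ℝ → ℝ := fun r => load M H Q fun e => g e r with hh
  have hhi : Integrable h := integrable_load M H Q hgi
  have hh0 : ∀ r, 0 ≤ h r := fun r => by
    have := load_mono hM H Q (f := fun _ => 0) (g := fun e => g e r) fun e => hg0 e r
    simpa [load, hh] using this
  have hah : ∀ ℓ ∈ L, ∀ r ∈ Set.Ico ((2 : ℝ) ^ (ℓ - 2)) (2 ^ (ℓ - 1)), a ℓ ≤ h r := by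
    intro ℓ hℓ r hr
    refine le_trans ?_ (load_mono hM H Q fun e => hgc e r)
    have hpos : (0 : ℝ) < Fintype.card (Equiv.Perm (Fin k)) := by exact_mod_cast Fintype.card_pos
    have heq : (load M H Q fun e => cutFraction c r e) =
        (∑ π : Equiv.Perm (Fin k), load M H Q fun e => if IsCut (cell c π r) e then 1 else 0) /
          Fintype.card (Equiv.Perm (Fin k)) := by
      rw [← load_sum, div_eq_inv_mul, ← load_const_mul]
      simp only [cutFraction, div_eq_inv_mul]
    rw [heq, le_div_iff₀ hpos, mul_comm, ← nsmul_eq_mul, ← Finset.card_univ]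
    exact Finset.card_nsmul_le_sum _ _ _ fun π _ => ha ℓ hℓ r hr π
  have hscale : ∀ ℓ ∈ L, 2 ^ (ℓ - 2) * a ℓ ≤
      ∫ r in Set.Ico ((2 : ℝ) ^ (ℓ - 2)) (2 ^ (ℓ - 1)), h r := by
    intro ℓ hℓ
    have hmono := setIntegral_mono_on (μ := volume) (integrableOn_const (by simp)) hhi.integrableOn
      measurableSet_Ico (hah ℓ hℓ)
    rw [setIntegral_const, Real.volume_real_Ico, smul_eq_mul] at hmono
    -- The window of radii has length `2 ^ (ℓ - 2)`, a quarter of the scale; hence the factor 4 in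
    -- the conclusion.
    have h2 : (2 : ℝ) ^ (ℓ - 1) = 2 * 2 ^ (ℓ - 2) := by
      rw [show ℓ - 1 = (ℓ - 2) + 1 by ring, zpow_add_one₀ (by norm_num)]
      ring
    have hp : (0 : ℝ) < 2 ^ (ℓ - 2) := by positivity
    rw [h2, max_eq_left (by linarith)] at hmono
    calc 2 ^ (ℓ - 2) * a ℓ = (2 * 2 ^ (ℓ - 2) - 2 ^ (ℓ - 2)) * a ℓ := by ring
      _ ≤ _ := by rwa [h2]
  -- Disjoint windows make the integral over all radii pay for every scale at once.
  have hdisj : (L : Set ℤ).PairwiseDisjoint fun ℓ : ℤ =>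
      Set.Ico ((2 : ℝ) ^ (ℓ - 2)) (2 ^ (ℓ - 1)) := by
    have key : ∀ ℓ ℓ' : ℤ, ℓ < ℓ' → Disjoint (Set.Ico ((2 : ℝ) ^ (ℓ - 2)) (2 ^ (ℓ - 1)))
        (Set.Ico ((2 : ℝ) ^ (ℓ' - 2)) (2 ^ (ℓ' - 1))) := by
      intro ℓ ℓ' hlt
      refine Set.disjoint_left.2 fun r hr hr' => ?_
      have : (2 : ℝ) ^ (ℓ - 1) ≤ 2 ^ (ℓ' - 2) := zpow_le_zpow_right₀ (by norm_num) (by omega)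
      exact absurd (hr.2.trans_le (this.trans hr'.1)) (lt_irrefl _)
    intro ℓ _ ℓ' _ hne
    rcases lt_or_gt_of_ne hne with hlt | hlt
    · exact key _ _ hlt
    · exact (key _ _ hlt).symm
  have htot : ∑ ℓ ∈ L, 2 ^ (ℓ - 2) * a ℓ ≤ (harmonic k : ℝ) * totalCost M H Q := by
    calc _ ≤ ∑ ℓ ∈ L, ∫ r in Set.Ico ((2 : ℝ) ^ (ℓ - 2)) (2 ^ (ℓ - 1)), h r :=
          Finset.sum_le_sum hscale
      _ = ∫ r in ⋃ ℓ ∈ L, Set.Ico ((2 : ℝ) ^ (ℓ - 2)) (2 ^ (ℓ - 1)), h r :=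
          (integral_biUnion_finset L (fun _ _ => measurableSet_Ico) hdisj
            fun _ _ => hhi.integrableOn).symm
      _ ≤ ∫ r, h r := setIntegral_le_integral hhi (Filter.Eventually.of_forall hh0)
      _ = load M H Q fun e => ∫ r, g e r := integral_load M H Q hgi
      _ ≤ load M H Q fun e => (harmonic k : ℝ) * edgeLength e := load_mono hM H Q hgl
      _ = _ := by rw [load_const_mul, load_edgeLength]
  have h4 : ∑ ℓ ∈ L, 2 ^ ℓ * a ℓ = 4 * ∑ ℓ ∈ L, 2 ^ (ℓ - 2) * a ℓ := by
    rw [Finset.mul_sum]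
    refine Finset.sum_congr rfl fun ℓ _ => ?_
    rw [zpow_sub₀ (by norm_num)]
    norm_num
    ring
  rw [h4]
  linarith

end Load

/-! ### Charging requests to the cut edges -/

section Charging

variable {V : Type*} {n : ℕ} {α : Type*}

/-- The edge `e` leaves the colour class `w` of `κ`. -/
def Leaves (κ : V → α) (w : α) (e : Sym2 V) : Prop := ∃ x y, e = s(x, y) ∧ κ x = w ∧ κ y ≠ w

theorem exists_leaves_of_connects {κ : V → α} {w : α} {E : Set (Sym2 V)} {u v : V}
    (h : Connects E u v) (hu : κ u = w) (hv : κ v ≠ w) : ∃ e ∈ E, Leaves κ w e := by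
  obtain ⟨p⟩ := h
  obtain ⟨d, -, hd1, hd2⟩ := p.exists_boundary_dart {x | κ x = w} hu hv
  have := d.adj
  rw [SimpleGraph.fromEdgeSet_adj] at this
  exact ⟨_, this.1, _, _, rfl, hd1, hd2⟩

/-- A cut edge leaves only the classes of its two endpoints. -/
theorem sum_leaves_le (κ : V → α) (s : Finset α) (e : Sym2 V) :
    ∑ w ∈ s, (if Leaves κ w e then (1 : ℝ) else 0) ≤ 2 * if IsCut κ e then 1 else 0 := by
  induction e using Sym2.ind with
  | _ u v =>
  rw [Finset.sum_boole]
  have hleave : ∀ w, Leaves κ w s(u, v) → κ u ≠ κ v ∧ (w = κ u ∨ w = κ v) := by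
    rintro w ⟨x, y, hxy, hx, hy⟩
    rcases Sym2.eq_iff.1 hxy with ⟨rfl, rfl⟩ | ⟨rfl, rfl⟩
    · exact ⟨fun h => hy (h ▸ hx), Or.inl hx.symm⟩
    · exact ⟨fun h => hy (h ▸ hx), Or.inr hx.symm⟩
  by_cases hc : κ u = κ v
  · rw [Finset.filter_false_of_mem fun w _ hw => (hleave w hw).1 hc]
    simp [IsCut, hc]
  · have : (s.filter fun w => Leaves κ w s(u, v)) ⊆ {κ u, κ v} := by
      intro w hw
      simpa using (hleave w (Finset.mem_filter.1 hw).2).2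
    rw [if_pos (by simpa [IsCut] using hc)]
    have := (Finset.card_le_card this).trans Finset.card_le_two
    rw [mul_one]
    exact_mod_cast this

/-- A set of requests, each charged to one of its terminals whose colour class it leaves, such that
no class receives more than `2 M` charges, is no larger than four times the weight of the edges
that every offline solution has between the colour classes. -/
theorem card_le_load_isCut {β : Type*} {M : ℝ} (hM : 0 ≤ M) {σ : Fin n → V × V}
    {H : Finset (Sym2 V)} {Q : Fin n → Finset (Sym2 V)} (hsol : IsOfflineSolution σ H Q)
    (κ : V → α) (U : Finset β) (req : β → Fin n) (hreq : Set.InjOn req U) (loc : β → V)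
    (hloc : ∀ u ∈ U, (loc u = (σ (req u)).1 ∧ κ (σ (req u)).2 ≠ κ (loc u)) ∨
      (loc u = (σ (req u)).2 ∧ κ (σ (req u)).1 ≠ κ (loc u)))
    (hclass : ∀ w, ∀ U' ⊆ U, (∀ u ∈ U', κ (loc u) = w) → (U'.card : ℝ) ≤ 2 * M) :
    (U.card : ℝ) ≤ 4 * load M H Q fun e => if IsCut κ e then 1 else 0 := by
  set W : Finset α := U.image fun u => κ (loc u) with hW
  have hw : ∀ w ∈ W, (({u ∈ U | κ (loc u) = w} : Finset β).card : ℝ) ≤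
      2 * load M H Q fun e => if Leaves κ w e then 1 else 0 := by
    intro w _
    have hQ0 : ∀ i, 0 ≤ ∑ e ∈ Q i, (if Leaves κ w e then (1 : ℝ) else 0) := fun i =>
      Finset.sum_nonneg fun e _ => by split_ifs <;> norm_num
    -- If `H` leaves the class, its weight `M` pays for at least half of the charges. Otherwise
    -- every charged request rents an edge leaving the class.
    by_cases hH : ∃ e ∈ H, Leaves κ w e
    · obtain ⟨e, heH, he⟩ := hH
      have h1 : (1 : ℝ) ≤ ∑ e ∈ H, if Leaves κ w e then (1 : ℝ) else 0 := by
        rw [Finset.sum_boole]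
        exact_mod_cast Finset.card_pos.2 ⟨e, by simp [heH, he]⟩
      have h2 : 0 ≤ ∑ i, ∑ e ∈ Q i, if Leaves κ w e then (1 : ℝ) else 0 :=
        Finset.sum_nonneg fun i _ => hQ0 i
      have h3 := mul_le_mul_of_nonneg_left h1 hM
      have h4 := hclass w _ (Finset.filter_subset (fun u => κ (loc u) = w) U)
        fun u hu => (Finset.mem_filter.1 hu).2
      unfold load
      linarith
    · push Not at hH
      have hreqQ : ∀ u ∈ ({u ∈ U | κ (loc u) = w} : Finset β),
          1 ≤ ∑ e ∈ Q (req u), if Leaves κ w e then (1 : ℝ) else 0 := by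
        intro u hu
        rw [Finset.mem_filter] at hu
        obtain ⟨e, he, hel⟩ : ∃ e ∈ (H : Set (Sym2 V)) ∪ Q (req u), Leaves κ w e := by
          rcases hloc u hu.1 with ⟨h1, h2⟩ | ⟨h1, h2⟩
          · exact exists_leaves_of_connects (hsol (req u)) (h1 ▸ hu.2) (hu.2 ▸ h2)
          · exact exists_leaves_of_connects (hsol (req u)).symm (h1 ▸ hu.2) (hu.2 ▸ h2)
        have heQ : e ∈ Q (req u) := by
          rcases he with he | he
          · exact absurd hel (hH e (by simpa using he))
          · simpa using he
        rw [Finset.sum_boole]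
        exact_mod_cast Finset.card_pos.2 ⟨e, by simp [heQ, hel]⟩
      have hle : (({u ∈ U | κ (loc u) = w} : Finset β).card : ℝ) ≤
          ∑ i, ∑ e ∈ Q i, if Leaves κ w e then (1 : ℝ) else 0 := by
        calc (({u ∈ U | κ (loc u) = w} : Finset β).card : ℝ)
            ≤ ∑ u ∈ ({u ∈ U | κ (loc u) = w} : Finset β),
                ∑ e ∈ Q (req u), if Leaves κ w e then (1 : ℝ) else 0 := by
              simpa using Finset.card_nsmul_le_sum _ _ _ hreqQ
          _ = ∑ i ∈ ({u ∈ U | κ (loc u) = w} : Finset β).image req,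
                ∑ e ∈ Q i, if Leaves κ w e then (1 : ℝ) else 0 := by
              rw [Finset.sum_image]
              exact hreq.mono fun u hu => (Finset.mem_filter.1 hu).1
          _ ≤ _ := Finset.sum_le_sum_of_subset_of_nonneg (Finset.subset_univ _)
              fun i _ _ => hQ0 i
      have h0 : 0 ≤ M * ∑ e ∈ H, if Leaves κ w e then (1 : ℝ) else 0 :=
        mul_nonneg hM (Finset.sum_nonneg fun e _ => by split_ifs <;> norm_num)
      have h1 : 0 ≤ ∑ i, ∑ e ∈ Q i, if Leaves κ w e then (1 : ℝ) else 0 :=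
        Finset.sum_nonneg fun i _ => hQ0 i
      unfold load
      linarith
  have hcard : (U.card : ℝ) = ∑ w ∈ W, (({u ∈ U | κ (loc u) = w} : Finset β).card : ℝ) := by
    exact_mod_cast Finset.card_eq_sum_card_image (fun u => κ (loc u)) U
  calc (U.card : ℝ) ≤ ∑ w ∈ W, 2 * load M H Q fun e => if Leaves κ w e then 1 else 0 :=
        hcard ▸ Finset.sum_le_sum hw
    _ = 2 * load M H Q fun e => ∑ w ∈ W, if Leaves κ w e then (1 : ℝ) else 0 := by
        rw [← Finset.mul_sum, load_sum]
    _ ≤ 2 * load M H Q fun e => 2 * if IsCut κ e then 1 else 0 := by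
        gcongr
        exact load_mono hM H Q fun e => sum_leaves_le κ W e
    _ = _ := by rw [load_const_mul]; ring

end Charging

/-! ### Forests -/

/-- The forest induced on `S` extends to a spanning tree of the complete graph on `S`, which has
`|S| - 1` edges. -/
theorem card_le_of_isAcyclic {α : Type*} {F : SimpleGraph α} (hF : F.IsAcyclic)
    (E : Finset (Sym2 α)) (S : Finset α) (hE : ∀ e ∈ E, e ∈ F.edgeSet)
    (hS : ∀ e ∈ E, ∀ x ∈ e, x ∈ S) : E.card ≤ S.card := by
  rcases S.eq_empty_or_nonempty with rfl | hne
  · have : E = ∅ := by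
      refine Finset.eq_empty_of_forall_notMem fun e he => ?_
      induction e using Sym2.ind with
      | _ u v => simpa using hS _ he u (Sym2.mem_mk_left u v)
    simp [this]
  have : Nonempty S := hne.to_subtype
  obtain ⟨T, hle, -, hT⟩ := SimpleGraph.connected_top.exists_isTree_le_of_le_of_isAcyclic
    (le_top : F.induce (S : Set α) ≤ ⊤) (hF.induce _)
  have hsub : E ⊆ T.edgeFinset.image (Sym2.map Subtype.val) := by
    intro e he
    induction e using Sym2.ind with
    | _ u v =>
    rw [Finset.mem_image]
    refine ⟨s(⟨u, hS _ he u (Sym2.mem_mk_left u v)⟩, ⟨v, hS _ he v (Sym2.mem_mk_right u v)⟩), ?_, rfl⟩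
    rw [SimpleGraph.mem_edgeFinset, SimpleGraph.mem_edgeSet]
    exact hle (hE _ he)
  have h1 := (Finset.card_le_card hsub).trans Finset.card_image_le
  have h2 := hT.card_edgeFinset
  rw [show Fintype.card (S : Set α) = S.card by simp] at h2
  omega

/-! ### The algorithm -/

/-- Names of the terminals of an unbounded sequence of requests. -/
abbrev Label : Type := ℕ × Bool

/-- The data that the algorithm maintains. Every request of positive length is charged at a level
`ℓ` to one of its terminals; terminals with many charged terminals of the same level nearby become
hubs of that level. Nearby hubs of equal or consecutive levels are connected by the forest of bought
edges. -/
structure State where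
  /-- The charged terminals with their levels. -/
  charged : Finset (ℤ × Label)
  /-- The hubs with their levels. -/
  hubs : Finset (ℤ × Label)
  /-- The bought edges. -/
  forest : SimpleGraph Label

/-- The terminal `u` is close to a hub of level `ℓ`. -/
def IsCovered (D : Label → Label → ℝ) (X : Finset (ℤ × Label)) (ℓ : ℤ) (u : Label) : Prop :=
  -- The factor 2 makes the crowds of radius `2 ^ ℓ` around different hubs of level `ℓ` disjoint.
  ∃ x, (ℓ, x) ∈ X ∧ D u x ≤ 2 * 2 ^ ℓ

/-- The hubs that have to be connected directly. -/
def hubGraph (D : Label → Label → ℝ) (X : Finset (ℤ × Label)) : SimpleGraph Label :=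
  SimpleGraph.fromRel fun x y =>
    -- The constant 6 admits hubs of levels `ℓ` and `ℓ + 1` that cover the same terminal (2 + 4),
    -- and hubs of level `ℓ` covering the ends of a request shorter than `2 * 2 ^ ℓ` (2 + 2 + 2).
    ∃ ℓ : ℤ, (ℓ, x) ∈ X ∧ ((ℓ, y) ∈ X ∨ (ℓ + 1, y) ∈ X) ∧ D x y ≤ 6 * 2 ^ ℓ

/-- A spanning forest of `G` that contains `F`. -/
def extendForest (F G : SimpleGraph Label) : SimpleGraph Label :=
  -- The default `F` never occurs when `F` is an acyclic subgraph of `G`.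
  if h : ∃ F' : SimpleGraph Label, F ≤ F' ∧ F' ≤ G ∧ F'.IsAcyclic ∧ F'.Reachable = G.Reachable
  then h.choose else F

/-- The scale of the request number `m`. -/
def topLevel (D : Label → Label → ℝ) (m : ℕ) : ℤ := Int.log 2 (D (m, false) (m, true))

/-- The levels at which the request number `m` has a terminal that is not covered. -/
def uncoveredLevels (D : Label → Label → ℝ) (X : Finset (ℤ × Label)) (m : ℕ) : Set ℤ :=
  {ℓ | ℓ ≤ topLevel D m ∧ ¬ (IsCovered D X ℓ (m, false) ∧ IsCovered D X ℓ (m, true))}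

/-- The level at which the request number `m` is charged. -/
def chargeLevel (D : Label → Label → ℝ) (X : Finset (ℤ × Label)) (m : ℕ) : ℤ :=
  sSup (uncoveredLevels D X m)

/-- The level at which, and the terminal to which the request number `m` is charged. -/
def charge (D : Label → Label → ℝ) (X : Finset (ℤ × Label)) (m : ℕ) : ℤ × Label :=
  -- The second terminal is selected exactly when the first is covered, so the charged terminal is
  -- uncovered.
  (chargeLevel D X m, (m, decide (IsCovered D X (chargeLevel D X m) (m, false))))

/-- The charged terminals of the same level near a charged terminal. -/
def crowd (D : Label → Label → ℝ) (T : Finset (ℤ × Label)) (q : ℤ × Label) :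
    Finset (ℤ × Label) :=
  {q' ∈ T | q'.1 = q.1 ∧ D q.2 q'.2 ≤ 2 ^ q.1}

/-- The hubs after a terminal `q` has been charged. -/
def promote (M : ℝ) (D : Label → Label → ℝ) (T X : Finset (ℤ × Label)) (q : ℤ × Label) :
    Finset (ℤ × Label) :=
  if M ≤ ((crowd D T q).card : ℝ) then insert q X else X

/-- The reaction to the request number `m`. -/
def step (M : ℝ) (D : Label → Label → ℝ) (m : ℕ) (S : State) : State :=
  if D (m, false) (m, true) = 0 then S else
    ⟨insert (charge D S.hubs m) S.charged,
      promote M D (insert (charge D S.hubs m) S.charged) S.hubs (charge D S.hubs m),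
      extendForest S.forest (hubGraph D
        (promote M D (insert (charge D S.hubs m) S.charged) S.hubs (charge D S.hubs m)))⟩

/-- A hub of level `ℓ` close to `u`. -/
def hubNear (D : Label → Label → ℝ) (X : Finset (ℤ × Label)) (ℓ : ℤ) (u : Label) : Label :=
  if h : IsCovered D X ℓ u then h.choose else u

/-- The edges that are rented for the request number `m`. -/
def rentEdges (D : Label → Label → ℝ) (X : Finset (ℤ × Label)) (m : ℕ) : Finset (Sym2 Label) :=
  if D (m, false) (m, true) = 0 then ∅
  else if chargeLevel D X m = topLevel D m then {s((m, false), (m, true))}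
  else {s((m, false), hubNear D X (chargeLevel D X m + 1) (m, false)),
    s((m, true), hubNear D X (chargeLevel D X m + 1) (m, true))}

/-- Replaces the labels of the requests after number `m`. -/
def clamp (m : ℕ) (a : Label) : Label := (min a.1 m, a.2)

/-- The distances that are known when the request number `m` arrives. -/
def restrictDist (m : ℕ) (D : Label → Label → ℝ) (a b : Label) : ℝ := D (clamp m a) (clamp m b)

/-- The state of the algorithm after the first `m` requests. -/
def run (M : ℝ) (D : Label → Label → ℝ) : ℕ → State
  | 0 => ⟨∅, ∅, ⊥⟩
  | m + 1 => step M (restrictDist m D) m (run M D m)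

/-- The edges that are rented at step `m`. -/
def rentAt (M : ℝ) (D : Label → Label → ℝ) (m : ℕ) : Finset (Sym2 Label) :=
  rentEdges (restrictDist m D) (run M D m).hubs m

/-! ### Dependence on the distances seen so far -/

theorem clamp_of_le {m : ℕ} {a : Label} (h : a.1 ≤ m) : clamp m a = a := by
  simp [clamp, h]

theorem restrictDist_restrictDist {l m : ℕ} (h : l ≤ m) (D : Label → Label → ℝ) :
    restrictDist l (restrictDist m D) = restrictDist l D := by
  funext a b
  simp only [restrictDist, clamp]
  congr 2 <;> omega

/-- The first `m + 1` steps consult only distances among requests up to `m`, so the state can be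
recomputed from the visible data. -/
theorem run_restrictDist {m : ℕ} (M : ℝ) (D : Label → Label → ℝ) {l : ℕ} (hl : l ≤ m + 1) :
    run M (restrictDist m D) l = run M D l := by
  induction l with
  | zero => rfl
  | succ l ih =>
    simp only [run]
    rw [ih (by omega), restrictDist_restrictDist (by omega)]

theorem rentAt_restrictDist (M : ℝ) (D : Label → Label → ℝ) (m : ℕ) :
    rentAt M (restrictDist m D) m = rentAt M D m := by
  unfold rentAt
  rw [run_restrictDist M D (Nat.le_succ m), restrictDist_restrictDist le_rfl]

theorem extendForest_spec {F G : SimpleGraph Label} (hF : F.IsAcyclic) (hFG : F ≤ G) :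
    F ≤ extendForest F G ∧ extendForest F G ≤ G ∧ (extendForest F G).IsAcyclic ∧
      (extendForest F G).Reachable = G.Reachable := by
  have h : ∃ F' : SimpleGraph Label,
      F ≤ F' ∧ F' ≤ G ∧ F'.IsAcyclic ∧ F'.Reachable = G.Reachable := by
    obtain ⟨F', h⟩ := SimpleGraph.exists_isAcyclic_reachable_eq_le_of_le_of_isAcyclic hFG hF
    exact ⟨F', by tauto⟩
  unfold extendForest
  rw [dif_pos h]
  exact h.choose_spec

theorem hubGraph_mono (D : Label → Label → ℝ) {X Y : Finset (ℤ × Label)} (h : X ⊆ Y) :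
    hubGraph D X ≤ hubGraph D Y := by
  have key : ∀ x y : Label,
      (∃ ℓ : ℤ, (ℓ, x) ∈ X ∧ ((ℓ, y) ∈ X ∨ (ℓ + 1, y) ∈ X) ∧ D x y ≤ 6 * 2 ^ ℓ) →
      ∃ ℓ : ℤ, (ℓ, x) ∈ Y ∧ ((ℓ, y) ∈ Y ∨ (ℓ + 1, y) ∈ Y) ∧ D x y ≤ 6 * 2 ^ ℓ :=
    fun x y ⟨ℓ, h1, h2, h3⟩ => ⟨ℓ, h h1, h2.imp (@h _) (@h _), h3⟩
  intro x y hxy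
  simp only [hubGraph, SimpleGraph.fromRel_adj] at hxy ⊢
  exact ⟨hxy.1, hxy.2.imp (key _ _) (key _ _)⟩

theorem hubGraph_reachable {D : Label → Label → ℝ} {X : Finset (ℤ × Label)} {ℓ : ℤ} {x y : Label}
    (hx : (ℓ, x) ∈ X) (hy : (ℓ, y) ∈ X ∨ (ℓ + 1, y) ∈ X) (hd : D x y ≤ 6 * 2 ^ ℓ) :
    (hubGraph D X).Reachable x y := by
  by_cases hxy : x = y
  · rw [hxy]
  · refine SimpleGraph.Adj.reachable ?_
    rw [hubGraph, SimpleGraph.fromRel_adj]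
    exact ⟨hxy, Or.inl ⟨ℓ, hx, hy, hd⟩⟩

theorem subset_promote (M : ℝ) (D : Label → Label → ℝ) (T X : Finset (ℤ × Label))
    (q : ℤ × Label) : X ⊆ promote M D T X q := by
  unfold promote
  split_ifs
  · exact Finset.subset_insert _ _
  · exact subset_rfl

theorem hubNear_spec {D : Label → Label → ℝ} {X : Finset (ℤ × Label)} {ℓ : ℤ} {u : Label}
    (h : IsCovered D X ℓ u) :
    (ℓ, hubNear D X ℓ u) ∈ X ∧ D u (hubNear D X ℓ u) ≤ 2 * 2 ^ ℓ := by
  unfold hubNear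
  rw [dif_pos h]
  exact h.choose_spec

/-- Only finitely many levels carry hubs, so some level below the top is uncovered, and a nonempty
set of integers bounded above attains its supremum. -/
theorem isGreatest_chargeLevel (D : Label → Label → ℝ) (X : Finset (ℤ × Label)) (m : ℕ) :
    IsGreatest (uncoveredLevels D X m) (chargeLevel D X m) := by
  have hbdd : BddAbove (uncoveredLevels D X m) := ⟨topLevel D m, fun ℓ h => h.1⟩
  obtain ⟨ℓ, hℓ, hnot⟩ := (Set.Iic_infinite (topLevel D m)).exists_notMem_finset
    (X.image Prod.fst)
  have hne : (uncoveredLevels D X m).Nonempty := by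
    refine ⟨ℓ, hℓ, fun h => hnot ?_⟩
    obtain ⟨x, hx, -⟩ := h.1
    exact Finset.mem_image_of_mem Prod.fst hx
  exact ⟨Int.csSup_mem hne hbdd, fun ℓ h => le_csSup hbdd h⟩

theorem chargeLevel_le (D : Label → Label → ℝ) (X : Finset (ℤ × Label)) (m : ℕ) :
    chargeLevel D X m ≤ topLevel D m := (isGreatest_chargeLevel D X m).1.1

theorem isCovered_of_chargeLevel_lt {D : Label → Label → ℝ} {X : Finset (ℤ × Label)} {m : ℕ}
    {ℓ : ℤ} (h1 : chargeLevel D X m < ℓ) (h2 : ℓ ≤ topLevel D m) (b : Bool) :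
    IsCovered D X ℓ (m, b) := by
  have : IsCovered D X ℓ (m, false) ∧ IsCovered D X ℓ (m, true) := by
    by_contra hcon
    exact absurd ((isGreatest_chargeLevel D X m).2 ⟨h2, hcon⟩) (not_le.2 h1)
  cases b
  exacts [this.1, this.2]

theorem not_isCovered_charge (D : Label → Label → ℝ) (X : Finset (ℤ × Label)) (m : ℕ) :
    ¬ IsCovered D X (charge D X m).1 (charge D X m).2 := by
  have h := (isGreatest_chargeLevel D X m).1.2
  unfold charge
  by_cases hc : IsCovered D X (chargeLevel D X m) (m, false)
  · simpa [hc] using h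
  · simp [hc]

/-! ### Invariants of the run -/

section Metric

variable {V : Type*} [MetricSpace V]

/-- The distances between located labels. -/
def labelDist (p : Label → V) (a b : Label) : ℝ := dist (p a) (p b)

theorem two_zpow_chargeLevel_le (p : Label → V) (X : Finset (ℤ × Label)) (m : ℕ)
    (h : labelDist p (m, false) (m, true) ≠ 0) :
    (2 : ℝ) ^ chargeLevel (labelDist p) X m ≤ labelDist p (m, false) (m, true) := by
  have hpos : 0 < labelDist p (m, false) (m, true) := lt_of_le_of_ne dist_nonneg h.symm
  calc (2 : ℝ) ^ chargeLevel (labelDist p) X m ≤ 2 ^ topLevel (labelDist p) m :=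
        zpow_le_zpow_right₀ (by norm_num) (chargeLevel_le _ _ _)
    _ ≤ _ := by exact_mod_cast Int.zpow_log_le_self (b := 2) (by norm_num) hpos

/-- The hubs that cover a terminal at consecutive levels are connected. -/
theorem reachable_of_isCovered {p : Label → V} {X : Finset (ℤ × Label)} {u : Label} {ℓ j : ℤ}
    (hℓj : ℓ ≤ j) (hcov : ∀ i, ℓ ≤ i → i ≤ j → IsCovered (labelDist p) X i u) {x : Label}
    (hx : (ℓ, x) ∈ X) (hxd : labelDist p u x ≤ 2 * 2 ^ ℓ) :
    ∃ y, (j, y) ∈ X ∧ labelDist p u y ≤ 2 * 2 ^ j ∧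
      (hubGraph (labelDist p) X).Reachable x y := by
  induction j, hℓj using Int.leInduction with
  | base => exact ⟨x, hx, hxd, .rfl⟩
  | succ j hj ih =>
    obtain ⟨y, hy, hyd, hxy⟩ := ih fun i h1 h2 => hcov i h1 (by omega)
    obtain ⟨z, hz, hzd⟩ := hcov (j + 1) (by omega) le_rfl
    refine ⟨z, hz, hzd, hxy.trans (hubGraph_reachable hy (Or.inr hz) ?_)⟩
    rw [zpow_add_one₀ (by norm_num)] at hzd
    have := dist_triangle_left (p y) (p z) (p u)
    unfold labelDist at *
    linarith

/-- The properties of the state after `m` requests on which the analysis is based. -/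
structure Invariant (M : ℝ) (p : Label → V) (m : ℕ) (S : State) : Prop where
  charged_lt : ∀ q ∈ S.charged, q.2.1 < m
  hubs_subset : S.hubs ⊆ S.charged
  charged_injOn : Set.InjOn (fun q : ℤ × Label => q.2.1) (S.charged : Set (ℤ × Label))
  charged_dist : ∀ q ∈ S.charged, (2 : ℝ) ^ q.1 ≤ labelDist p (q.2.1, false) (q.2.1, true)
  hubs_separated : ∀ q ∈ S.hubs, ∀ q' ∈ S.hubs, q.1 = q'.1 → q ≠ q' →
    2 * 2 ^ q.1 < labelDist p q.2 q'.2
  hubs_crowd : ∀ q ∈ S.hubs, M ≤ ((crowd (labelDist p) S.charged q).card : ℝ)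
  -- A hub of level `ℓ` in `C` covers all of `C`, so no later charge of this level falls there. Up
  -- to `M` charges fit without a hub, and the one that creates the hub may add one more.
  class_card : ∀ (ℓ : ℤ) (C : Set Label), (∀ x ∈ C, ∀ y ∈ C, labelDist p x y ≤ 2 ^ ℓ) →
    (({q ∈ S.charged | q.1 = ℓ ∧ q.2 ∈ C} : Finset (ℤ × Label)).card : ℝ) ≤ M + 1 ∧
    ((∀ q ∈ S.hubs, q.1 = ℓ → q.2 ∉ C) →
      (({q ∈ S.charged | q.1 = ℓ ∧ q.2 ∈ C} : Finset (ℤ × Label)).card : ℝ) ≤ M)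
  forest_le : S.forest ≤ hubGraph (labelDist p) S.hubs
  forest_isAcyclic : S.forest.IsAcyclic
  forest_reachable : S.forest.Reachable = (hubGraph (labelDist p) S.hubs).Reachable

theorem Invariant.zero {M : ℝ} (hM : 0 ≤ M) (p : Label → V) : Invariant M p 0 ⟨∅, ∅, ⊥⟩ where
  charged_lt := by simp
  hubs_subset := by simp
  charged_injOn := by simp
  charged_dist := by simp
  hubs_separated := by simp
  hubs_crowd := by simp
  class_card := by
    intro ℓ C _
    simp only [Finset.filter_empty, Finset.card_empty, Nat.cast_zero]
    exact ⟨by linarith, fun _ => hM⟩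
  forest_le := bot_le
  forest_isAcyclic := SimpleGraph.isAcyclic_bot
  forest_reachable := by
    have : hubGraph (labelDist p) ∅ = ⊥ := by
      ext x y
      simp [hubGraph]
    rw [this]

theorem hubGraph_congr {D D' : Label → Label → ℝ} {X : Finset (ℤ × Label)}
    (h : ∀ q ∈ X, ∀ q' ∈ X, D q.2 q'.2 = D' q.2 q'.2) : hubGraph D X = hubGraph D' X := by
  have key : ∀ x y : Label,
      (∃ ℓ : ℤ, (ℓ, x) ∈ X ∧ ((ℓ, y) ∈ X ∨ (ℓ + 1, y) ∈ X) ∧ D x y ≤ 6 * 2 ^ ℓ) ↔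
      ∃ ℓ : ℤ, (ℓ, x) ∈ X ∧ ((ℓ, y) ∈ X ∨ (ℓ + 1, y) ∈ X) ∧ D' x y ≤ 6 * 2 ^ ℓ := by
    refine fun x y => exists_congr fun ℓ => and_congr_right fun hx => and_congr_right fun hy => ?_
    rcases hy with hy | hy
    · rw [h _ hx _ hy]
    · rw [h _ hx _ hy]
  ext x y
  simp only [hubGraph, SimpleGraph.fromRel_adj, key]

/-- Allows the true locations to be exchanged for those clamped at the current request, as the state
involves earlier labels only. -/
theorem Invariant.congr {M : ℝ} {p p' : Label → V} {m : ℕ} {S : State} (hS : Invariant M p m S)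
    (h : ∀ a : Label, a.1 < m → p a = p' a) : Invariant M p' m S := by
  have hD : ∀ a b : Label, a.1 < m → b.1 < m → labelDist p a b = labelDist p' a b := by
    intro a b ha hb
    rw [labelDist, labelDist, h a ha, h b hb]
  have hT := hS.charged_lt
  have hX : ∀ q ∈ S.hubs, q.2.1 < m := fun q hq => hT q (hS.hubs_subset hq)
  have hG : hubGraph (labelDist p) S.hubs = hubGraph (labelDist p') S.hubs :=
    hubGraph_congr fun q hq q' hq' => hD _ _ (hX q hq) (hX q' hq')
  refine ⟨hT, hS.hubs_subset, hS.charged_injOn, ?_, ?_, ?_, ?_, hG ▸ hS.forest_le,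
    hS.forest_isAcyclic, hG ▸ hS.forest_reachable⟩
  · intro q hq
    rw [← hD (q.2.1, false) (q.2.1, true) (hT q hq) (hT q hq)]
    exact hS.charged_dist q hq
  · intro q hq q' hq'
    rw [← hD _ _ (hX q hq) (hX q' hq')]
    exact hS.hubs_separated q hq q' hq'
  · intro q hq
    have : crowd (labelDist p') S.charged q = crowd (labelDist p) S.charged q := by
      refine Finset.filter_congr fun q' hq' => ?_
      rw [hD _ _ (hX q hq) (hT q' hq')]
    rw [this]
    exact hS.hubs_crowd q hq
  · intro ℓ C hC
    have hcc := hS.class_card ℓ (C ∩ {a | a.1 < m}) fun x hx y hy => by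
      rw [hD _ _ hx.2 hy.2]
      exact hC x hx.1 y hy.1
    have : ({q ∈ S.charged | q.1 = ℓ ∧ q.2 ∈ C} : Finset (ℤ × Label)) =
        {q ∈ S.charged | q.1 = ℓ ∧ q.2 ∈ C ∩ {a | a.1 < m}} :=
      Finset.filter_congr fun q hq => by simp [hT q hq]
    rw [this]
    refine ⟨by convert hcc.1, fun h' => ?_⟩
    convert hcc.2 fun q hq hqℓ hqC => h' q hq hqℓ hqC.1

theorem Invariant.step {M : ℝ} {p : Label → V} {m : ℕ} {S : State} (hS : Invariant M p m S) :
    Invariant M p (m + 1) (step M (labelDist p) m S) := by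
  unfold RentOrBuy.step
  split_ifs with h0
  · exact { hS with charged_lt := fun q hq => (hS.charged_lt q hq).trans (Nat.lt_succ_self m) }
  set q₀ := charge (labelDist p) S.hubs m with hq₀
  set T := insert q₀ S.charged with hT
  set X := promote M (labelDist p) T S.hubs q₀ with hX
  have hq₀m : q₀.2.1 = m := rfl
  have hq₀T : q₀ ∉ S.charged := fun h => absurd (hS.charged_lt _ h) (by rw [hq₀m]; exact lt_irrefl _)
  -- The charged terminal is uncovered. Both the separation of hubs and the bound on charges in a
  -- class rest on this.
  have hunc : ∀ q ∈ S.hubs, q.1 = q₀.1 → 2 * 2 ^ q₀.1 < labelDist p q₀.2 q.2 := by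
    intro q hq hl
    by_contra hcon
    exact not_isCovered_charge (labelDist p) S.hubs m
      ⟨q.2, by rw [← hq₀, ← hl]; exact hq, not_lt.1 hcon⟩
  have hST : S.charged ⊆ T := Finset.subset_insert _ _
  have hXsub : X ⊆ insert q₀ S.hubs := by
    rw [hX, promote]
    split_ifs
    exacts [subset_rfl, Finset.subset_insert _ _]
  have hXcases : ∀ q ∈ X, q = q₀ ∨ q ∈ S.hubs := fun q hq => Finset.mem_insert.1 (hXsub hq)
  have hforest := extendForest_spec hS.forest_isAcyclic
    (hS.forest_le.trans (hubGraph_mono (labelDist p) (subset_promote M (labelDist p) T S.hubs q₀)))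
  refine ⟨?_, ?_, ?_, ?_, ?_, ?_, ?_, hforest.2.1, hforest.2.2.1, hforest.2.2.2⟩
  · intro q hq
    rcases Finset.mem_insert.1 hq with rfl | hq
    · exact Nat.lt_succ_self m
    · exact (hS.charged_lt q hq).trans (Nat.lt_succ_self m)
  · intro q hq
    rcases hXcases q hq with rfl | hq
    · exact Finset.mem_insert_self _ _
    · exact hST (hS.hubs_subset hq)
  · rw [hT, Finset.coe_insert, Set.injOn_insert (by simpa using hq₀T)]
    refine ⟨hS.charged_injOn, ?_⟩
    rintro ⟨q, hq, hqe⟩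
    exact absurd (hS.charged_lt q hq) (by simp only at hqe; omega)
  · intro q hq
    rcases Finset.mem_insert.1 hq with rfl | hq
    · exact two_zpow_chargeLevel_le p S.hubs m h0
    · exact hS.charged_dist q hq
  · intro q hq q' hq' hl hne
    rcases hXcases q hq with rfl | hq <;> rcases hXcases q' hq' with rfl | hq'
    · exact absurd rfl hne
    · exact hunc q' hq' hl.symm
    · have := hunc q hq hl
      rw [hl]
      rwa [labelDist, dist_comm] at this
    · exact hS.hubs_separated q hq q' hq' hl hne
  · intro q hq
    by_cases hqS : q ∈ S.hubs
    · refine (hS.hubs_crowd q hqS).trans ?_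
      exact_mod_cast Finset.card_le_card (Finset.filter_subset_filter _ hST)
    · have hqq : q = q₀ := (hXcases q hq).resolve_right hqS
      subst hqq
      by_contra hcon
      rw [hX, promote, if_neg hcon] at hq
      exact hqS hq
  · intro ℓ C hC
    have hold := hS.class_card ℓ C hC
    have hsub : S.hubs ⊆ X := subset_promote M (labelDist p) T S.hubs q₀
    by_cases hmem : q₀.1 = ℓ ∧ q₀.2 ∈ C
    · have hno : ∀ q ∈ S.hubs, q.1 = ℓ → q.2 ∉ C := by
        intro q hq hl hqC
        have h1 := hunc q hq (hl.trans hmem.1.symm)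
        have h2 := hC _ hmem.2 _ hqC
        have h3 : (0 : ℝ) < 2 ^ ℓ := by positivity
        rw [hmem.1] at h1
        linarith
      rw [hT, Finset.filter_insert, if_pos hmem,
        Finset.card_insert_of_notMem fun h => hq₀T (Finset.mem_filter.1 h).1]
      push_cast
      refine ⟨by linarith [hold.2 hno], fun hnone => ?_⟩
      have hnp : ¬ M ≤ ((crowd (labelDist p) T q₀).card : ℝ) := by
        intro hp
        refine hnone q₀ ?_ hmem.1 hmem.2
        show q₀ ∈ X
        rw [hX, promote, if_pos hp]
        exact Finset.mem_insert_self _ _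
      -- The crowd of `q₀` contains all charges of level `ℓ` in `C`, and `q₀` itself.
      have hle : ({q ∈ S.charged | q.1 = ℓ ∧ q.2 ∈ C} : Finset (ℤ × Label)).card + 1 ≤
          (crowd (labelDist p) T q₀).card := by
        rw [← Finset.card_insert_of_notMem (a := q₀) fun h => hq₀T (Finset.mem_filter.1 h).1]
        refine Finset.card_le_card fun q hq => ?_
        have hqT : q ∈ T ∧ q.1 = ℓ ∧ q.2 ∈ C := by
          rcases Finset.mem_insert.1 hq with rfl | hq
          · exact ⟨Finset.mem_insert_self _ _, hmem⟩
          · exact ⟨hST (Finset.mem_filter.1 hq).1, (Finset.mem_filter.1 hq).2⟩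
        refine Finset.mem_filter.2 ⟨hqT.1, hqT.2.1.trans hmem.1.symm, ?_⟩
        rw [hmem.1]
        exact hC _ hmem.2 _ hqT.2.2
      have hle' : ((({q ∈ S.charged | q.1 = ℓ ∧ q.2 ∈ C} : Finset (ℤ × Label)).card : ℕ) : ℝ) + 1 ≤
          (crowd (labelDist p) T q₀).card := by exact_mod_cast hle
      exact hle'.trans (not_le.1 hnp).le
    · rw [hT, Finset.filter_insert, if_neg hmem]
      exact ⟨hold.1, fun h => hold.2 fun q hq => h q (hsub hq)⟩

theorem invariant_run {M : ℝ} (hM : 0 ≤ M) (p : Label → V) (m : ℕ) :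
    Invariant M p m (run M (labelDist p) m) := by
  induction m with
  | zero => exact Invariant.zero hM p
  | succ m ih =>
    -- The distances given by `p ∘ clamp m` are by definition the restricted distances used at this
    -- step.
    have h1 := (ih.congr (p' := p ∘ clamp m) fun a ha => by simp [clamp_of_le ha.le]).step
    exact h1.congr fun a ha => by simp [clamp_of_le (Nat.lt_succ_iff.1 ha)]

theorem forest_mono_step {M : ℝ} {p : Label → V} {m : ℕ} {S : State} (hS : Invariant M p m S) :
    S.forest ≤ (step M (labelDist p) m S).forest := by
  unfold step
  split_ifs
  · exact le_rfl
  · exact (extendForest_spec hS.forest_isAcyclic (hS.forest_le.trans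
      (hubGraph_mono (labelDist p) (subset_promote _ _ _ _ _)))).1

theorem forest_mono {M : ℝ} (hM : 0 ≤ M) (p : Label → V) :
    Monotone fun m => (run M (labelDist p) m).forest := by
  refine monotone_nat_of_le_succ fun m => ?_
  exact forest_mono_step
    ((invariant_run hM p m).congr (p' := p ∘ clamp m) fun a ha => by simp [clamp_of_le ha.le])

/-! ### Feasibility -/

/-- Below the top level, each terminal rents an edge to a hub one level above the charge. From there
chains of covering hubs climb to the top level, where the two ends are close enough to be adjacent
or equal in `hubGraph`. -/
theorem step_serves {M : ℝ} {p : Label → V} {m : ℕ} {S : State} (hS : Invariant M p m S)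
    (h0 : labelDist p (m, false) (m, true) ≠ 0) :
    (SimpleGraph.fromEdgeSet ((step M (labelDist p) m S).forest.edgeSet ∪
      (rentEdges (labelDist p) S.hubs m : Set (Sym2 Label)))).Reachable (m, false) (m, true) := by
  set Γ := SimpleGraph.fromEdgeSet ((step M (labelDist p) m S).forest.edgeSet ∪
      (rentEdges (labelDist p) S.hubs m : Set (Sym2 Label))) with hΓ
  have hrent : ∀ x y, s(x, y) ∈ rentEdges (labelDist p) S.hubs m → Γ.Reachable x y := by
    intro x y hxy
    by_cases h : x = y
    · rw [h]
    · refine SimpleGraph.Adj.reachable ?_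
      rw [hΓ, SimpleGraph.fromEdgeSet_adj]
      exact ⟨Or.inr hxy, h⟩
  by_cases htop : chargeLevel (labelDist p) S.hubs m = topLevel (labelDist p) m
  · refine hrent _ _ ?_
    rw [rentEdges, if_neg h0, if_pos htop]
    exact Finset.mem_singleton_self _
  have hlt : chargeLevel (labelDist p) S.hubs m < topLevel (labelDist p) m :=
    lt_of_le_of_ne (chargeLevel_le _ _ _) htop
  set ℓ := chargeLevel (labelDist p) S.hubs m + 1 with hℓ
  set j := topLevel (labelDist p) m with hj
  have hcov : ∀ b i, ℓ ≤ i → i ≤ j → IsCovered (labelDist p) S.hubs i (m, b) :=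
    fun b i h1 h2 => isCovered_of_chargeLevel_lt (by omega) h2 b
  have hhub : ∀ b, ∃ y, (j, y) ∈ S.hubs ∧ labelDist p (m, b) y ≤ 2 * 2 ^ j ∧
      (hubGraph (labelDist p) S.hubs).Reachable (hubNear (labelDist p) S.hubs ℓ (m, b)) y := by
    intro b
    have hn := hubNear_spec (hcov b ℓ le_rfl (by omega))
    exact reachable_of_isCovered (by omega) (hcov b) hn.1 hn.2
  have hforest : ∀ {x y}, (hubGraph (labelDist p) S.hubs).Reachable x y → Γ.Reachable x y := by
    intro x y hxy
    rw [← hS.forest_reachable] at hxy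
    refine hxy.mono (le_trans (forest_mono_step (M := M) hS) ?_)
    rw [hΓ]
    intro u v huv
    rw [SimpleGraph.fromEdgeSet_adj]
    exact ⟨Or.inl huv, huv.ne⟩
  obtain ⟨y, hy, hyd, hyr⟩ := hhub false
  obtain ⟨z, hz, hzd, hzr⟩ := hhub true
  have hpos : 0 < labelDist p (m, false) (m, true) := lt_of_le_of_ne dist_nonneg h0.symm
  have hyz : labelDist p y z ≤ 6 * 2 ^ j := by
    have h1 : labelDist p (m, false) (m, true) < 2 ^ (j + 1) := by
      exact_mod_cast Int.lt_zpow_succ_log_self (b := 2) (by norm_num)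
        (labelDist p (m, false) (m, true))
    rw [zpow_add_one₀ (by norm_num)] at h1
    have h2 := dist_triangle4 (p y) (p (m, false)) (p (m, true)) (p z)
    rw [dist_comm (p y) (p (m, false))] at h2
    unfold labelDist at *
    linarith
  have hr : rentEdges (labelDist p) S.hubs m =
      {s((m, false), hubNear (labelDist p) S.hubs ℓ (m, false)),
        s((m, true), hubNear (labelDist p) S.hubs ℓ (m, true))} := by
    rw [rentEdges, if_neg h0, if_neg htop]
  have ha := hrent (m, false) _ (by rw [hr]; exact Finset.mem_insert_self _ _)
  have hb := hrent (m, true) _ (by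
    rw [hr]; exact Finset.mem_insert_of_mem (Finset.mem_singleton_self _))
  exact ha.trans ((hforest hyr).trans ((hforest (hubGraph_reachable hy (Or.inl hz) hyz)).trans
    ((hforest hzr).symm.trans hb.symm)))

/-! ### The cost of the algorithm in terms of the charges -/

/-- The sum of the scales of the charged terminals. -/
def potential (S : State) : ℝ := ∑ q ∈ S.charged, (2 : ℝ) ^ q.1

/-- The potential grows by `2 ^ ℓ`. A direct edge is shorter than `2 * 2 ^ ℓ`; otherwise two hubs of
level `ℓ + 1` are reached, each within `4 * 2 ^ ℓ`. -/
theorem rentEdges_cost_le {M : ℝ} {p : Label → V} {m : ℕ} {S : State} (hS : Invariant M p m S) :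
    ∑ e ∈ rentEdges (labelDist p) S.hubs m, edgeLength (e.map p) ≤
      8 * (potential (step M (labelDist p) m S) - potential S) := by
  unfold rentEdges step
  split_ifs with h0 htop
  · simp
  all_goals
    have hq : charge (labelDist p) S.hubs m ∉ S.charged := fun h =>
      absurd (hS.charged_lt _ h) (lt_irrefl m)
    simp only [potential]
    rw [Finset.sum_insert hq, add_sub_cancel_right]
    change _ ≤ 8 * (2 : ℝ) ^ chargeLevel (labelDist p) S.hubs m
  · rw [Finset.sum_singleton]
    have h1 : labelDist p (m, false) (m, true) < 2 ^ (topLevel (labelDist p) m + 1) := by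
      exact_mod_cast Int.lt_zpow_succ_log_self (b := 2) (by norm_num)
        (labelDist p (m, false) (m, true))
    rw [zpow_add_one₀ (by norm_num), ← htop] at h1
    have h2 : (0 : ℝ) < 2 ^ chargeLevel (labelDist p) S.hubs m := by positivity
    have h3 : edgeLength (s((m, false), (m, true)).map p) =
      labelDist p (m, false) (m, true) := rfl
    rw [h3]
    linarith
  · have hlt : chargeLevel (labelDist p) S.hubs m < topLevel (labelDist p) m :=
      lt_of_le_of_ne (chargeLevel_le _ _ _) htop
    have hd : ∀ b, labelDist p (m, b) (hubNear (labelDist p) S.hubs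
        (chargeLevel (labelDist p) S.hubs m + 1) (m, b)) ≤
        4 * 2 ^ chargeLevel (labelDist p) S.hubs m := by
      intro b
      have := (hubNear_spec (isCovered_of_chargeLevel_lt
        (lt_add_one (chargeLevel (labelDist p) S.hubs m)) (by omega) b)).2
      rw [zpow_add_one₀ (by norm_num)] at this
      linarith
    have hf := hd false
    have ht := hd true
    have hnn : ∀ e : Sym2 Label, 0 ≤ edgeLength (e.map p) := by
      intro e
      induction e using Sym2.ind with
      | _ u v => exact dist_nonneg
    have hpair : ∀ e e' : Sym2 Label, ∑ x ∈ ({e, e'} : Finset (Sym2 Label)),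
        edgeLength (x.map p) ≤ edgeLength (e.map p) + edgeLength (e'.map p) := by
      intro e e'
      by_cases h : e = e'
      · subst h
        simpa using hnn e
      · rw [Finset.sum_pair h]
    refine (hpair _ _).trans ?_
    change labelDist p _ _ + labelDist p _ _ ≤ _
    linarith

theorem exists_level_of_mem_hubGraph (p : Label → V) (X : Finset (ℤ × Label)) (e : Sym2 Label)
    (he : e ∈ (hubGraph (labelDist p) X).edgeSet) : ∃ ℓ : ℤ, ℓ ∈ X.image Prod.fst ∧
      (∀ x ∈ e, (ℓ, x) ∈ X ∨ (ℓ + 1, x) ∈ X) ∧ edgeLength (e.map p) ≤ 6 * 2 ^ ℓ := by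
  induction e using Sym2.ind with
  | _ u v =>
  have key : ∀ x y : Label, (∃ ℓ : ℤ, (ℓ, x) ∈ X ∧ ((ℓ, y) ∈ X ∨ (ℓ + 1, y) ∈ X) ∧
      labelDist p x y ≤ 6 * 2 ^ ℓ) → ∃ ℓ : ℤ, ℓ ∈ X.image Prod.fst ∧
      (∀ z ∈ s(x, y), (ℓ, z) ∈ X ∨ (ℓ + 1, z) ∈ X) ∧ edgeLength (s(x, y).map p) ≤ 6 * 2 ^ ℓ := by
    rintro x y ⟨ℓ, hx, hy, hd⟩
    refine ⟨ℓ, Finset.mem_image_of_mem Prod.fst hx, fun z hz => ?_, hd⟩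
    rcases Sym2.mem_iff.1 hz with rfl | rfl
    exacts [Or.inl hx, hy]
  rw [SimpleGraph.mem_edgeSet, hubGraph, SimpleGraph.fromRel_adj] at he
  rcases he.2 with h | h
  · exact key u v h
  · rw [Sym2.eq_swap]
    exact key v u h

/-- The edges of the forest are paid for by the hubs. -/
theorem forest_cost_le {M : ℝ} {p : Label → V} {m : ℕ} {S : State} (hS : Invariant M p m S)
    (E : Finset (Sym2 Label)) (hE : ∀ e ∈ E, e ∈ S.forest.edgeSet) :
    ∑ e ∈ E, edgeLength (e.map p) ≤ 9 * ∑ q ∈ S.hubs, (2 : ℝ) ^ q.1 := by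
  have hex : ∀ e : Sym2 Label, ∃ ℓ : ℤ, e ∈ E → ℓ ∈ S.hubs.image Prod.fst ∧
      (∀ x ∈ e, (ℓ, x) ∈ S.hubs ∨ (ℓ + 1, x) ∈ S.hubs) ∧ edgeLength (e.map p) ≤ 6 * 2 ^ ℓ := by
    intro e
    by_cases he : e ∈ E
    · obtain ⟨ℓ, h⟩ := exists_level_of_mem_hubGraph p S.hubs e
        (SimpleGraph.edgeSet_mono hS.forest_le (hE e he))
      exact ⟨ℓ, fun _ => h⟩
    · exact ⟨0, fun h => absurd h he⟩
  choose level hlevel using hex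
  -- Edges of level `ℓ` form a forest on the hubs of levels `ℓ` and `ℓ + 1`. At `6 * 2 ^ ℓ` per
  -- edge, a hub pays 6 times its scale at its own level and 3 times at the level below; hence 9.
  have hcard : ∀ ℓ : ℤ, (({e ∈ E | level e = ℓ} : Finset (Sym2 Label)).card : ℝ) ≤
      (({q ∈ S.hubs | q.1 = ℓ} : Finset (ℤ × Label)).card : ℝ) +
        (({q ∈ S.hubs | q.1 - 1 = ℓ} : Finset (ℤ × Label)).card : ℝ) := by
    intro ℓ
    have h1 := card_le_of_isAcyclic hS.forest_isAcyclic {e ∈ E | level e = ℓ}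
      (({q ∈ S.hubs | q.1 = ℓ} ∪ {q ∈ S.hubs | q.1 - 1 = ℓ} : Finset (ℤ × Label)).image Prod.snd)
      (fun e he => hE e (Finset.mem_filter.1 he).1) (by
        intro e he x hx
        rw [Finset.mem_filter] at he
        obtain ⟨he, rfl⟩ := he
        rw [Finset.mem_image]
        rcases (hlevel e he).2.1 x hx with h | h
        · exact ⟨_, Finset.mem_union_left _ (Finset.mem_filter.2 ⟨h, rfl⟩), rfl⟩
        · exact ⟨_, Finset.mem_union_right _ (Finset.mem_filter.2 ⟨h, by simp⟩), rfl⟩)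
    exact_mod_cast h1.trans (Finset.card_image_le.trans (Finset.card_union_le _ _))
  have hfib : ∀ g : ℤ × Label → ℤ, ∑ ℓ ∈ S.hubs.image Prod.fst,
      (2 : ℝ) ^ ℓ * (({q ∈ S.hubs | g q = ℓ} : Finset (ℤ × Label)).card : ℝ) ≤
        ∑ q ∈ S.hubs, (2 : ℝ) ^ g q := by
    intro g
    refine le_trans (le_of_eq ?_) (Finset.sum_fiberwise_le_sum_of_sum_fiber_nonneg (g := g)
      (t := S.hubs.image Prod.fst) fun ℓ _ => Finset.sum_nonneg fun q _ => by positivity)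
    refine Finset.sum_congr rfl fun ℓ _ => ?_
    rw [Finset.sum_congr rfl (g := fun _ => (2 : ℝ) ^ ℓ) fun q hq => by
      rw [(Finset.mem_filter.1 hq).2], Finset.sum_const, nsmul_eq_mul, mul_comm]
  calc ∑ e ∈ E, edgeLength (e.map p) ≤ ∑ e ∈ E, 6 * (2 : ℝ) ^ level e :=
        Finset.sum_le_sum fun e he => (hlevel e he).2.2
    _ = ∑ ℓ ∈ S.hubs.image Prod.fst, ∑ e ∈ E with level e = ℓ, 6 * (2 : ℝ) ^ level e :=
        (Finset.sum_fiberwise_of_maps_to (fun e he => (hlevel e he).1) _).symm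
    _ ≤ ∑ ℓ ∈ S.hubs.image Prod.fst, (6 * ((2 : ℝ) ^ ℓ *
          (({q ∈ S.hubs | q.1 = ℓ} : Finset (ℤ × Label)).card : ℝ)) +
          6 * ((2 : ℝ) ^ ℓ * (({q ∈ S.hubs | q.1 - 1 = ℓ} : Finset (ℤ × Label)).card : ℝ))) := by
        refine Finset.sum_le_sum fun ℓ _ => ?_
        rw [Finset.sum_congr rfl (g := fun _ => 6 * (2 : ℝ) ^ ℓ) fun e he => by
          rw [(Finset.mem_filter.1 he).2], Finset.sum_const, nsmul_eq_mul]
        have h2 : (0 : ℝ) ≤ 6 * 2 ^ ℓ := by positivity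
        have := mul_le_mul_of_nonneg_right (hcard ℓ) h2
        linarith
    _ ≤ 6 * ∑ q ∈ S.hubs, (2 : ℝ) ^ q.1 + 6 * ∑ q ∈ S.hubs, (2 : ℝ) ^ (q.1 - 1) := by
        rw [Finset.sum_add_distrib, ← Finset.mul_sum, ← Finset.mul_sum]
        gcongr
        · exact hfib fun q => q.1
        · exact hfib fun q => q.1 - 1
    _ = _ := by
        have : ∑ q ∈ S.hubs, (2 : ℝ) ^ (q.1 - 1) = 2⁻¹ * ∑ q ∈ S.hubs, (2 : ℝ) ^ q.1 := by
          rw [Finset.mul_sum]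
          refine Finset.sum_congr rfl fun q _ => ?_
          rw [zpow_sub_one₀ (by norm_num), mul_comm]
        rw [this]
        ring

/-- The crowds of the hubs are disjoint, and each contains at least `M` charges of the scale of its
hub. -/
theorem hubs_cost_le {M : ℝ} {p : Label → V} {m : ℕ} {S : State} (hS : Invariant M p m S) :
    M * ∑ q ∈ S.hubs, (2 : ℝ) ^ q.1 ≤ potential S := by
  have hdisj : (S.hubs : Set (ℤ × Label)).PairwiseDisjoint
      fun q => crowd (labelDist p) S.charged q := by
    intro q hq q' hq' hne
    refine Finset.disjoint_left.2 fun r hr hr' => ?_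
    replace hr := Finset.mem_filter.1 hr
    replace hr' := Finset.mem_filter.1 hr'
    have hl : q.1 = q'.1 := hr.2.1.symm.trans hr'.2.1
    have h1 := hS.hubs_separated q hq q' hq' hl hne
    have h2 := dist_triangle_right (p q.2) (p q'.2) (p r.2)
    have h3 := hr.2.2
    have h4 := hr'.2.2
    rw [← hl] at h4
    unfold labelDist at *
    linarith
  calc M * ∑ q ∈ S.hubs, (2 : ℝ) ^ q.1 = ∑ q ∈ S.hubs, M * (2 : ℝ) ^ q.1 := Finset.mul_sum _ _ _
    _ ≤ ∑ q ∈ S.hubs, ∑ q' ∈ crowd (labelDist p) S.charged q, (2 : ℝ) ^ q'.1 := by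
        refine Finset.sum_le_sum fun q hq => ?_
        rw [Finset.sum_congr rfl (g := fun _ => (2 : ℝ) ^ q.1) fun q' hq' => by
          rw [(Finset.mem_filter.1 hq').2.1], Finset.sum_const, nsmul_eq_mul]
        exact mul_le_mul_of_nonneg_right (hS.hubs_crowd q hq) (by positivity)
    _ = ∑ q' ∈ S.hubs.biUnion fun q => crowd (labelDist p) S.charged q, (2 : ℝ) ^ q'.1 :=
        (Finset.sum_biUnion hdisj).symm
    _ ≤ potential S := by
        refine Finset.sum_le_sum_of_subset_of_nonneg ?_ fun q _ _ => by positivity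
        exact Finset.biUnion_subset.2 fun q _ => Finset.filter_subset _ _

end Metric

/-! ### The online algorithm -/

/-- The label of a terminal. -/
def ofIndex {m : ℕ} (a : TerminalIndex m) : Label := (a.1, a.2)

/-- The terminal with a given label. -/
def toIndex (m : ℕ) (a : Label) : TerminalIndex (m + 1) := (⟨min a.1 m, by omega⟩, a.2)

/-- The distance matrix of the first requests as a function of labels. -/
def extendDist (m : ℕ) (D : TerminalIndex (m + 1) → TerminalIndex (m + 1) → ℝ)
    (a b : Label) : ℝ := D (toIndex m a) (toIndex m b)

/-- The algorithm buys the forest of hubs. If `M < 1`, it plays as if `M = 1` and also buys the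
edges that it would rent. -/
def hubAlgorithm : OnlineAlgorithm where
  -- The whole current forest is listed at every step; since the forests grow, their union is the
  -- last one.
  buy M m D := {e | e.map ofIndex ∈ (run (max M 1) (extendDist m D) (m + 1)).forest.edgeSet ∨
    M < 1 ∧ e.map ofIndex ∈ rentAt (max M 1) (extendDist m D) m}
  rent M m D := {e | ¬ M < 1 ∧ e.map ofIndex ∈ rentAt (max M 1) (extendDist m D) m}

section Labels

variable {V : Type*} {n : ℕ} {σ : Fin n → V × V} {p : Label → V}

/-- The function `p` locates the labels of all terminals of `σ`. -/
def Locates (σ : Fin n → V × V) (p : Label → V) : Prop :=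
  ∀ (i : Fin n) (b : Bool), p (i, b) = terminal σ (i, b)

theorem exists_locates (σ : Fin n → V × V) (hn : 0 < n) : ∃ p, Locates σ p := by
  refine ⟨fun a => terminal σ (⟨min a.1 (n - 1), by omega⟩, a.2), fun i b => ?_⟩
  have : (⟨min (i : ℕ) (n - 1), by omega⟩ : Fin n) = i := Fin.ext (by simp only; omega)
  simp only [this]

theorem Locates.fst (hp : Locates σ p) (i : Fin n) : p (i, false) = (σ i).1 := by
  simp [hp i, terminal]

theorem Locates.snd (hp : Locates σ p) (i : Fin n) : p (i, true) = (σ i).2 := by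
  simp [hp i, terminal]

theorem Locates.seenTerminal_eq (hp : Locates σ p) (i : Fin n) :
    seenTerminal σ i = p ∘ ofIndex := by
  funext a
  exact (hp (Fin.castLE i.isLt a.1) a.2).symm

/-- Edges between labels that have been seen give rise to edges between seen terminals. -/
theorem Locates.mem_image (hp : Locates σ p) (i : Fin n) {A : Set (Sym2 Label)} {e : Sym2 Label}
    (he : e ∈ A) (hlt : ∀ x ∈ e, x.1 ≤ i) :
    ∃ e' : Sym2 (TerminalIndex (i + 1)), e'.map ofIndex ∈ A ∧
      e'.map (seenTerminal σ i) = e.map p := by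
  have hof : ∀ x ∈ e, ofIndex (toIndex i x) = x := fun x hx => clamp_of_le (hlt x hx)
  have hmap : (e.map (toIndex i)).map ofIndex = e := by
    rw [Sym2.map_map]
    exact (Sym2.map_congr (g := id) fun x hx => hof x hx).trans (congrFun Sym2.map_id e)
  refine ⟨e.map (toIndex i), by rwa [hmap], ?_⟩
  rw [hp.seenTerminal_eq, ← Sym2.map_map, hmap]

end Labels

/-! ### Passing from labels to vertices -/

variable {V : Type*} [MetricSpace V] {n : ℕ}

theorem edgeLength_nonneg (e : Sym2 V) : 0 ≤ edgeLength e := by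
  induction e using Sym2.ind with
  | _ u v => exact dist_nonneg

theorem edgeCost_le_of_subset_image {ι : Type*} {H : Finset (Sym2 V)} {E : Finset (Sym2 ι)}
    {p : ι → V} (h : H ⊆ E.image (Sym2.map p)) :
    edgeCost H ≤ ∑ e ∈ E, edgeLength (e.map p) :=
  (Finset.sum_le_sum_of_subset_of_nonneg h fun e _ _ => edgeLength_nonneg e).trans
    (Finset.sum_image_le_of_nonneg fun e _ => edgeLength_nonneg e)

theorem edgeCost_union_le (H H' : Finset (Sym2 V)) :
    edgeCost (H ∪ H') ≤ edgeCost H + edgeCost H' := by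
  have h1 := Finset.sum_union_inter (s₁ := H) (s₂ := H') (f := fun e => edgeLength e)
  have h2 : 0 ≤ ∑ e ∈ H ∩ H', edgeLength e := Finset.sum_nonneg fun e _ => edgeLength_nonneg e
  unfold edgeCost
  linarith

theorem edgeCost_biUnion_le {ι : Type*} (s : Finset ι) (Q : ι → Finset (Sym2 V)) :
    edgeCost (s.biUnion Q) ≤ ∑ i ∈ s, edgeCost (Q i) := by
  induction s using Finset.induction_on with
  | empty => simp [edgeCost]
  | insert i s hi ih =>
    rw [Finset.biUnion_insert, Finset.sum_insert hi]
    exact (edgeCost_union_le _ _).trans (by linarith)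

theorem reachable_image {V ι : Type*} (p : ι → V) {A : Set (Sym2 ι)} {a b : ι}
    (h : (SimpleGraph.fromEdgeSet A).Reachable a b) : Connects (Sym2.map p '' A) (p a) (p b) := by
  obtain ⟨w⟩ := h
  induction w with
  | nil => exact SimpleGraph.Reachable.rfl
  | @cons u v _ huv _ ih =>
    refine SimpleGraph.Reachable.trans ?_ ih
    by_cases hp : p u = p v
    · rw [hp]
    · refine SimpleGraph.Adj.reachable ?_
      rw [SimpleGraph.fromEdgeSet_adj] at huv ⊢
      exact ⟨⟨s(u, v), huv.1, rfl⟩, hp⟩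

section Located

variable {σ : Fin n → V × V} {p : Label → V}

theorem Locates.extendDist_seenDist (hp : Locates σ p) (i : Fin n) :
    extendDist i (seenDist σ i) = restrictDist i (labelDist p) := by
  funext a b
  simp only [extendDist, seenDist, hp.seenTerminal_eq]
  rfl

theorem forest_label_lt {M : ℝ} {m : ℕ} {S : State} (hS : Invariant M p m S)
    {e : Sym2 Label} (he : e ∈ S.forest.edgeSet) {x : Label} (hx : x ∈ e) : x.1 < m := by
  obtain ⟨ℓ, -, h, -⟩ := exists_level_of_mem_hubGraph p S.hubs e
    (SimpleGraph.edgeSet_mono hS.forest_le he)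
  rcases h x hx with h | h
  · exact hS.charged_lt _ (hS.hubs_subset h)
  · exact hS.charged_lt _ (hS.hubs_subset h)

theorem rentEdges_label_le {M : ℝ} {m : ℕ} {S : State} (hS : Invariant M p m S)
    (D : Label → Label → ℝ) {e : Sym2 Label} (he : e ∈ rentEdges D S.hubs m) {x : Label}
    (hx : x ∈ e) : x.1 ≤ m := by
  have hhub : ∀ ℓ b, (hubNear D S.hubs ℓ (m, b)).1 ≤ m := by
    intro ℓ b
    by_cases h : IsCovered D S.hubs ℓ (m, b)
    · exact (hS.charged_lt _ (hS.hubs_subset (hubNear_spec h).1)).le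
    · rw [hubNear, dif_neg h]
  unfold rentEdges at he
  split_ifs at he
  · simp at he
  · rw [Finset.mem_singleton] at he
    subst he
    rcases Sym2.mem_iff.1 hx with rfl | rfl <;> exact le_rfl
  · rw [Finset.mem_insert, Finset.mem_singleton] at he
    rcases he with rfl | rfl <;> rcases Sym2.mem_iff.1 hx with rfl | rfl
    exacts [le_rfl, hhub _ _, le_rfl, hhub _ _]

theorem rentAt_cost_le {M : ℝ} (hM : 0 ≤ M) (p : Label → V) (m : ℕ) :
    ∑ e ∈ rentAt M (labelDist p) m, edgeLength (e.map p) ≤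
      8 * (potential (run M (labelDist p) (m + 1)) - potential (run M (labelDist p) m)) := by
  have hS := invariant_run hM p m
  have h := rentEdges_cost_le (hS.congr (p' := p ∘ clamp m) fun a ha => by
    simp [clamp_of_le ha.le])
  refine le_trans (le_of_eq ?_) h
  refine Finset.sum_congr rfl fun e he => ?_
  rw [Sym2.map_congr (g := p ∘ clamp m)]
  intro x hx
  rw [Function.comp_apply, clamp_of_le (rentEdges_label_le hS _ he hx)]

theorem Locates.mem_boughtAt (hp : Locates σ p) (M : ℝ) (i : Fin n) (f : Sym2 V) :
    f ∈ hubAlgorithm.boughtAt M σ i ↔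
      f ∈ Sym2.map p '' (run (max M 1) (labelDist p) (i + 1)).forest.edgeSet ∨
        M < 1 ∧ f ∈ Sym2.map p '' (rentAt (max M 1) (labelDist p) i : Set (Sym2 Label)) := by
  have hM : 0 ≤ max M 1 := le_max_of_le_right zero_le_one
  have hS := invariant_run hM p i
  have hS' := invariant_run hM p (i + 1)
  simp only [OnlineAlgorithm.boughtAt, hubAlgorithm, Finset.mem_image, Finset.mem_filter,
    Finset.mem_univ, true_and, hp.extendDist_seenDist, run_restrictDist _ _ le_rfl,
    rentAt_restrictDist]
  constructor
  · rintro ⟨e, he, rfl⟩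
    rw [hp.seenTerminal_eq, ← Sym2.map_map]
    exact he.imp (fun h => ⟨_, h, rfl⟩) fun h => ⟨h.1, _, h.2, rfl⟩
  · rintro (⟨e, he, rfl⟩ | ⟨hM1, e, he, rfl⟩)
    · obtain ⟨e', h1, h2⟩ := hp.mem_image i he fun x hx =>
        Nat.lt_succ_iff.1 (forest_label_lt hS' he hx)
      exact ⟨e', Or.inl h1, h2⟩
    · obtain ⟨e', h1, h2⟩ := hp.mem_image i he fun x hx => rentEdges_label_le hS _ he hx
      exact ⟨e', Or.inr ⟨hM1, h1⟩, h2⟩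

theorem Locates.mem_rentedAt (hp : Locates σ p) (M : ℝ) (i : Fin n) (f : Sym2 V) :
    f ∈ hubAlgorithm.rentedAt M σ i ↔
      ¬ M < 1 ∧ f ∈ Sym2.map p '' (rentAt (max M 1) (labelDist p) i : Set (Sym2 Label)) := by
  have hS := invariant_run (M := max M 1) (le_max_of_le_right zero_le_one) p i
  simp only [OnlineAlgorithm.rentedAt, hubAlgorithm, Finset.mem_image, Finset.mem_filter,
    Finset.mem_univ, true_and, hp.extendDist_seenDist, rentAt_restrictDist]
  constructor
  · rintro ⟨e, he, rfl⟩
    rw [hp.seenTerminal_eq, ← Sym2.map_map]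
    exact ⟨he.1, _, he.2, rfl⟩
  · rintro ⟨hM1, e, he, rfl⟩
    obtain ⟨e', h1, h2⟩ := hp.mem_image i he fun x hx => rentEdges_label_le hS _ he hx
    exact ⟨e', ⟨hM1, h1⟩, h2⟩

theorem hubAlgorithm_serves (M : ℝ) (σ : Fin n → V × V) : hubAlgorithm.Serves M σ := by
  intro i
  obtain ⟨p, hp⟩ := exists_locates σ i.pos
  have hM : 0 ≤ max M 1 := le_max_of_le_right zero_le_one
  rw [← hp.fst i, ← hp.snd i]
  by_cases h0 : labelDist p (i, false) (i, true) = 0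
  · rw [dist_eq_zero.1 h0]
    exact SimpleGraph.Reachable.rfl
  have hc : ∀ b, clamp i ((i : ℕ), b) = ((i : ℕ), b) := fun b => clamp_of_le le_rfl
  have hserve := step_serves ((invariant_run hM p i).congr (p' := p ∘ clamp i) fun a ha => by
    simp [clamp_of_le ha.le]) (by simpa [labelDist, hc] using h0)
  refine (reachable_image p hserve).mono (SimpleGraph.fromEdgeSet_mono ?_)
  rintro _ ⟨e, he | he, rfl⟩
  · refine Or.inl ?_
    rw [Finset.mem_coe, OnlineAlgorithm.boughtUpTo, Finset.mem_biUnion]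
    exact ⟨i, Finset.mem_Iic.2 le_rfl, (hp.mem_boughtAt M i _).2 (Or.inl ⟨e, he, rfl⟩)⟩
  · by_cases hM1 : M < 1
    · refine Or.inl ?_
      rw [Finset.mem_coe, OnlineAlgorithm.boughtUpTo, Finset.mem_biUnion]
      exact ⟨i, Finset.mem_Iic.2 le_rfl, (hp.mem_boughtAt M i _).2 (Or.inr ⟨hM1, e, he, rfl⟩)⟩
    · exact Or.inr ((hp.mem_rentedAt M i _).2 ⟨hM1, e, he, rfl⟩)

/-- The constant is 9 for the forest plus 8 for the rented edges. If `M < 1`, both are bought at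
price `M`, which gives the factor `min M 1`. -/
theorem hubAlgorithm_cost_le (hp : Locates σ p) {M : ℝ} (hM : 0 ≤ M) :
    hubAlgorithm.cost M σ ≤ min M 1 * (17 * potential (run (max M 1) (labelDist p) n)) := by
  have hM' : 0 ≤ max M 1 := le_max_of_le_right zero_le_one
  have hS := invariant_run hM' p n
  set S := run (max M 1) (labelDist p) n with hSdef
  obtain ⟨E, hE⟩ : ∃ E : Finset (Sym2 Label), ∀ e, e ∈ E ↔ e ∈ S.forest.edgeSet := by
    refine ⟨{e ∈ (S.hubs.image Prod.snd).sym2 | e ∈ S.forest.edgeSet}, fun e => ?_⟩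
    rw [Finset.mem_filter, and_iff_right_iff_imp, Finset.mem_sym2_iff]
    intro he x hx
    obtain ⟨ℓ, -, h, -⟩ := exists_level_of_mem_hubGraph p S.hubs e
      (SimpleGraph.edgeSet_mono hS.forest_le he)
    rw [Finset.mem_image]
    rcases h x hx with h | h
    exacts [⟨_, h, rfl⟩, ⟨_, h, rfl⟩]
  have hforest : max M 1 * ∑ e ∈ E, edgeLength (e.map p) ≤ 9 * potential S := by
    have h1 := mul_le_mul_of_nonneg_left (forest_cost_le hS E fun e he => (hE e).1 he) hM'
    have h2 := hubs_cost_le hS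
    linarith
  have hrent : ∑ i : Fin n, ∑ e ∈ rentAt (max M 1) (labelDist p) i, edgeLength (e.map p) ≤
      8 * potential S := by
    rw [Fin.sum_univ_eq_sum_range
      fun i => ∑ e ∈ rentAt (max M 1) (labelDist p) i, edgeLength (e.map p)]
    refine (Finset.sum_le_sum fun i _ => rentAt_cost_le hM' p i).trans ?_
    rw [← Finset.mul_sum, Finset.sum_range_sub fun i => potential (run (max M 1) (labelDist p) i)]
    have : potential (run (max M 1) (labelDist p) 0) = 0 := by simp [potential, run]
    rw [this, sub_zero]
  have hbought : ∀ f ∈ hubAlgorithm.bought M σ, f ∈ E.image (Sym2.map p) ∨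
      M < 1 ∧ ∃ i : Fin n, f ∈ (rentAt (max M 1) (labelDist p) i).image (Sym2.map p) := by
    intro f hf
    rw [OnlineAlgorithm.bought, Finset.mem_biUnion] at hf
    obtain ⟨i, -, hf⟩ := hf
    rcases (hp.mem_boughtAt M i f).1 hf with ⟨e, he, rfl⟩ | ⟨hM1, e, he, rfl⟩
    · refine Or.inl (Finset.mem_image_of_mem _ ((hE e).2 ?_))
      exact SimpleGraph.edgeSet_mono (forest_mono hM' p i.isLt) he
    · exact Or.inr ⟨hM1, i, Finset.mem_image_of_mem _ he⟩
  have hrented : ∀ i, hubAlgorithm.rentedAt M σ i ⊆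
      (rentAt (max M 1) (labelDist p) i).image (Sym2.map p) := by
    intro i f hf
    obtain ⟨-, e, he, rfl⟩ := (hp.mem_rentedAt M i f).1 hf
    exact Finset.mem_image_of_mem _ he
  unfold OnlineAlgorithm.cost totalCost
  by_cases hM1 : M < 1
  · have hr0 : ∀ i, hubAlgorithm.rentedAt M σ i = ∅ := fun i =>
      Finset.eq_empty_of_forall_notMem fun f hf => ((hp.mem_rentedAt M i f).1 hf).1 hM1
    have hb : edgeCost (hubAlgorithm.bought M σ) ≤ ∑ e ∈ E, edgeLength (e.map p) +
        ∑ i : Fin n, ∑ e ∈ rentAt (max M 1) (labelDist p) i, edgeLength (e.map p) := by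
      have hsub : hubAlgorithm.bought M σ ⊆ E.image (Sym2.map p) ∪ Finset.univ.biUnion
          fun i : Fin n => (rentAt (max M 1) (labelDist p) i).image (Sym2.map p) := by
        intro f hf
        rcases hbought f hf with h | ⟨-, i, h⟩
        · exact Finset.mem_union_left _ h
        · exact Finset.mem_union_right _ (Finset.mem_biUnion.2 ⟨i, Finset.mem_univ _, h⟩)
      have h1 : edgeCost (hubAlgorithm.bought M σ) ≤ _ :=
        Finset.sum_le_sum_of_subset_of_nonneg hsub fun f _ _ => edgeLength_nonneg f
      refine h1.trans ((edgeCost_union_le _ _).trans (add_le_add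
        (edgeCost_le_of_subset_image subset_rfl) ((edgeCost_biUnion_le _ _).trans ?_)))
      exact Finset.sum_le_sum fun i _ => edgeCost_le_of_subset_image subset_rfl
    rw [max_eq_right hM1.le, one_mul] at hforest
    rw [min_eq_left hM1.le]
    simp only [hr0]
    have : edgeCost (∅ : Finset (Sym2 V)) = 0 := Finset.sum_empty
    simp only [this, Finset.sum_const_zero, add_zero]
    exact mul_le_mul_of_nonneg_left (by rw [max_eq_right hM1.le] at *; linarith) hM
  · have hM1' := not_lt.1 hM1
    rw [max_eq_left hM1'] at hforest
    have hb : edgeCost (hubAlgorithm.bought M σ) ≤ ∑ e ∈ E, edgeLength (e.map p) :=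
      edgeCost_le_of_subset_image fun f hf => (hbought f hf).resolve_right fun h => hM1 h.1
    have hb' := mul_le_mul_of_nonneg_left hb hM
    have hr : ∑ i, edgeCost (hubAlgorithm.rentedAt M σ i) ≤
        ∑ i : Fin n, ∑ e ∈ rentAt (max M 1) (labelDist p) i, edgeLength (e.map p) :=
      Finset.sum_le_sum fun i _ => edgeCost_le_of_subset_image (hrented i)
    rw [min_eq_right hM1', one_mul]
    linarith

/-! ### Comparison with the optimum -/

/-- Ball partitions centered at the terminals have classes of diameter below `2 ^ ℓ`. `M ≥ 1` turns
`M + 1` charges per class into `2 M`. The constant 16 is 4 from the charging times 4 from the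
windows of radii. -/
theorem potential_le (hn : 0 < n) (hp : Locates σ p) {M : ℝ} (hM : 1 ≤ M)
    {H : Finset (Sym2 V)} {Q : Fin n → Finset (Sym2 V)} (hsol : IsOfflineSolution σ H Q) :
    potential (run M (labelDist p) n) ≤
      16 * (harmonic (numTerminals σ) : ℝ) * totalCost M H Q := by
  have hM0 : 0 ≤ M := by linarith
  have hS := invariant_run hM0 p n
  set S := run M (labelDist p) n with hSdef
  set K := Finset.univ.image (terminal σ) with hK
  set c : Fin (numTerminals σ) → V := fun w => (K.equivFin.symm w : V) with hc
  have hcenter : ∀ q ∈ S.charged, ∀ b, ∃ w, p (q.2.1, b) = c w := by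
    intro q hq b
    have hmem : p (q.2.1, b) ∈ K := by
      rw [hp ⟨q.2.1, hS.charged_lt q hq⟩ b]
      exact Finset.mem_image_of_mem _ (Finset.mem_univ _)
    exact ⟨K.equivFin ⟨_, hmem⟩, by simp [hc]⟩
  have hscale := sum_scales_le c hM0 H Q (S.charged.image Prod.fst)
    (fun ℓ => (({q ∈ S.charged | q.1 = ℓ} : Finset (ℤ × Label)).card : ℝ) / 4) (by
      intro ℓ _ r hr π
      have hr2 : 2 * r < 2 ^ ℓ := by
        have h1 := hr.2
        rw [zpow_sub_one₀ (by norm_num)] at h1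
        linarith
      have hr0 : 0 ≤ r := le_trans (by positivity) hr.1
      have htop : ∀ q ∈ S.charged, ∀ b, cell c π r (p (q.2.1, b)) ≠ ⊤ := by
        intro q hq b
        obtain ⟨w, hw⟩ := hcenter q hq b
        rw [hw]
        exact cell_center_ne_top c π hr0 w
      have hsep : ∀ q ∈ S.charged, q.1 = ℓ →
          cell c π r (p (q.2.1, false)) ≠ cell c π r (p (q.2.1, true)) := by
        intro q hq hl heq
        have h1 := dist_le_of_cell_eq heq (htop q hq false)
        have h2 := hS.charged_dist q hq
        rw [hl] at h2
        unfold labelDist at h2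
        linarith
      have hcard := card_le_load_isCut hM0 hsol (cell c π r)
        ({q ∈ S.charged | q.1 = ℓ} : Finset (ℤ × Label))
        -- The minimum only makes the index total; charged requests have numbers below `n`.
        (fun q => ⟨min q.2.1 (n - 1), by omega⟩) (by
          intro q hq q' hq' h
          rw [Finset.mem_coe, Finset.mem_filter] at hq hq'
          refine hS.charged_injOn hq.1 hq'.1 ?_
          have h1 := hS.charged_lt q hq.1
          have h2 := hS.charged_lt q' hq'.1
          simp only [Fin.mk.injEq] at h
          show q.2.1 = q'.2.1
          omega)
        (fun q => p q.2) (by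
          rintro ⟨ℓ', i, b⟩ hq
          rw [Finset.mem_filter] at hq
          have hi := hS.charged_lt _ hq.1
          have heq : (⟨min i (n - 1), by omega⟩ : Fin n) = ⟨i, hi⟩ := by
            ext
            simp only at hi ⊢
            omega
          have hs := hsep _ hq.1 hq.2
          have h1 := hp.fst ⟨i, hi⟩
          have h2 := hp.snd ⟨i, hi⟩
          simp only [heq] at h1 h2 hs ⊢
          rw [← h1, ← h2]
          cases b
          · exact Or.inl ⟨rfl, hs.symm⟩
          · exact Or.inr ⟨rfl, hs⟩) (by
          intro w U' hU' hw'
          rcases U'.eq_empty_or_nonempty with rfl | ⟨q₁, hq₁⟩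
          · simpa using hM0
          have hw : w ≠ ⊤ := by
            rw [← hw' q₁ hq₁]
            exact htop q₁ (Finset.mem_filter.1 (hU' hq₁)).1 q₁.2.2
          obtain ⟨C, hC⟩ : ∃ C : Set Label, ∀ x, x ∈ C ↔ cell c π r (p x) = w :=
            ⟨{x | cell c π r (p x) = w}, fun _ => Iff.rfl⟩
          have hle := (hS.class_card ℓ C (by
            intro x hx y hy
            rw [hC] at hx hy
            exact (dist_le_of_cell_eq (hx.trans hy.symm) (hx ▸ hw)).trans hr2.le)).1
          refine (Nat.cast_le.2 (Finset.card_le_card fun q hq => ?_)).trans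
            (hle.trans (show M + 1 ≤ 2 * M by linarith))
          have hqU := Finset.mem_filter.1 (hU' hq)
          exact Finset.mem_filter.2 ⟨hqU.1, hqU.2, (hC _).2 (hw' q hq)⟩)
      linarith)
  have hpot : potential S = 4 * ∑ ℓ ∈ S.charged.image Prod.fst,
      2 ^ ℓ * ((({q ∈ S.charged | q.1 = ℓ} : Finset (ℤ × Label)).card : ℝ) / 4) := by
    rw [potential, ← Finset.sum_fiberwise_of_maps_to
      (fun q hq => Finset.mem_image_of_mem Prod.fst hq), Finset.mul_sum]
    refine Finset.sum_congr rfl fun ℓ _ => ?_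
    rw [Finset.sum_congr rfl (g := fun _ => (2 : ℝ) ^ ℓ) fun q hq => by
      rw [(Finset.mem_filter.1 hq).2], Finset.sum_const, nsmul_eq_mul]
    ring
  rw [hpot]
  linarith

end Located

/-- For `M < 1`, scaling the costs at price 1 by `M` keeps the purchases and does not increase the
rents. -/
theorem min_mul_totalCost_le (M : ℝ) (H : Finset (Sym2 V))
    (Q : Fin n → Finset (Sym2 V)) : min M 1 * totalCost (max M 1) H Q ≤ totalCost M H Q := by
  have hQ : 0 ≤ ∑ i, edgeCost (Q i) :=
    Finset.sum_nonneg fun i _ => Finset.sum_nonneg fun e _ => edgeLength_nonneg e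
  unfold totalCost
  rcases le_total M 1 with h | h
  · rw [min_eq_left h, max_eq_right h]
    nlinarith
  · rw [min_eq_right h, max_eq_left h, one_mul]

theorem hubAlgorithm_cost_le_totalCost {M : ℝ} (hM : 0 ≤ M) {σ : Fin n → V × V} (hn : 0 < n)
    {H : Finset (Sym2 V)} {Q : Fin n → Finset (Sym2 V)} (hsol : IsOfflineSolution σ H Q) :
    hubAlgorithm.cost M σ ≤ 272 * (harmonic (numTerminals σ) : ℝ) * totalCost M H Q := by
  obtain ⟨p, hp⟩ := exists_locates σ hn
  have hmin : 0 ≤ min M 1 := le_min hM zero_le_one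
  have hharm : (0 : ℝ) ≤ harmonic (numTerminals σ) := by
    rw [harmonic]
    push_cast
    positivity
  calc hubAlgorithm.cost M σ
      ≤ min M 1 * (17 * potential (run (max M 1) (labelDist p) n)) := hubAlgorithm_cost_le hp hM
    _ ≤ min M 1 * (17 * (16 * (harmonic (numTerminals σ) : ℝ) * totalCost (max M 1) H Q)) := by
        gcongr
        exact potential_le hn hp (le_max_right _ _) hsol
    _ = 272 * (harmonic (numTerminals σ) : ℝ) * (min M 1 * totalCost (max M 1) H Q) := by ring
    _ ≤ _ := by
        gcongr
        exact min_mul_totalCost_le M H Q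

/-- Needed because `log k` vanishes here: all terminals coincide, so every edge used is a loop. -/
theorem OnlineAlgorithm.cost_eq_zero (A : OnlineAlgorithm) (M : ℝ) {σ : Fin n → V × V}
    (hk : numTerminals σ ≤ 1) : A.cost M σ = 0 := by
  have hzero : ∀ (i : Fin n) (e : Sym2 (TerminalIndex (i + 1))),
      edgeLength (e.map (seenTerminal σ i)) = 0 := by
    intro i e
    induction e using Sym2.ind with
    | _ a b =>
    refine dist_eq_zero.2 (Finset.card_le_one.1 hk _ ?_ _ ?_) <;>
      exact Finset.mem_image_of_mem _ (Finset.mem_univ _)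
  have hb : edgeCost (A.bought M σ) = 0 := by
    refine Finset.sum_eq_zero fun f hf => ?_
    rw [OnlineAlgorithm.bought, Finset.mem_biUnion] at hf
    obtain ⟨i, -, hf⟩ := hf
    obtain ⟨e, -, rfl⟩ := Finset.mem_image.1 hf
    exact hzero i e
  have hr : ∀ i, edgeCost (A.rentedAt M σ i) = 0 := by
    refine fun i => Finset.sum_eq_zero fun f hf => ?_
    obtain ⟨e, -, rfl⟩ := Finset.mem_image.1 hf
    exact hzero i e
  simp [OnlineAlgorithm.cost, totalCost, hb, hr]

theorem hubAlgorithm_cost_le_opt {M : ℝ} (hM : 0 ≤ M) (σ : Fin n → V × V) :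
    hubAlgorithm.cost M σ ≤ 816 * Real.log (numTerminals σ) * opt M σ := by
  by_cases hk : numTerminals σ ≤ 1
  · rw [hubAlgorithm.cost_eq_zero M hk]
    have : Real.log (numTerminals σ) = 0 := by
      interval_cases h : numTerminals σ <;> simp
    simp [this]
  push Not at hk
  have hn : 0 < n := by
    rcases Nat.eq_zero_or_pos n with rfl | h
    · simp [numTerminals] at hk
    · exact h
  -- For `k ≥ 2` this absorbs the 1 of `1 + log k` into `3 * log k`, and `816 = 3 * 272` with `272 =
  -- 17 * 16`.
  have hlog2 : 1 / 2 < Real.log (numTerminals σ) := by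
    have h1 : Real.log 2 ≤ Real.log (numTerminals σ) :=
      Real.log_le_log (by norm_num) (by exact_mod_cast hk)
    have := Real.log_two_gt_d9
    linarith
  have hharm : (harmonic (numTerminals σ) : ℝ) ≤ 3 * Real.log (numTerminals σ) := by
    have := harmonic_le_one_add_log (numTerminals σ)
    linarith
  have hpos : 0 < 816 * Real.log (numTerminals σ) := by linarith
  rw [← div_le_iff₀' hpos]
  obtain ⟨H₀, Q₀, h₀⟩ := exists_isOfflineSolution σ
  refine le_csInf ⟨_, H₀, Q₀, h₀, rfl⟩ ?_
  rintro _ ⟨H, Q, hsol, rfl⟩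
  rw [div_le_iff₀' hpos]
  refine (hubAlgorithm_cost_le_totalCost hM hn hsol).trans ?_
  have h := mul_le_mul_of_nonneg_right hharm (totalCost_nonneg hM H Q)
  linarith

end

end RentOrBuy

theorem theorem2 :
    ∃ (A : RentOrBuy.OnlineAlgorithm) (C : ℝ), 0 < C ∧
      ∀ (V : Type*) [MetricSpace V] (M : ℝ), 0 ≤ M →
        ∀ (n : ℕ) (σ : Fin n → V × V),
          A.Serves M σ ∧
            A.cost M σ ≤ C * Real.log (RentOrBuy.numTerminals σ) * RentOrBuy.opt M σ :=
  ⟨RentOrBuy.hubAlgorithm, 816, by norm_num, fun _ _ M hM _ σ =>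
    ⟨RentOrBuy.hubAlgorithm_serves M σ, RentOrBuy.hubAlgorithm_cost_le_opt hM σ⟩⟩
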